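/- Setting. Let $\mathcal X$ be a set, $\psi:\mathcal X\to\mathcal K_\psi$ a feature map into a real Hilbert space, $k_\psi(x,x')=\langle\psi(x),\psi(x')\rangle$, and suppose $|k_\psi(x,x')|\le M$ for all $x,x'$, where $M>0$. Let $B>0$, $H_\psi=\{x\mapsto\langle v,\psi(x)\rangle : v\in\mathcal K_\psi,\ \langle v,v\rangle\le B\}$, $\epsilon>0$ and $0<\delta<1$. Write $\log_1 t=\max(1,\log t)$ and $\mathrm{clip}_{0,1}(t)=\max(0,\min(1,t))$. For a sample $\mathcal S=(x_i,y_i)_{i=1}^m\in(\mathcal X\times[0,1])^m$ put $$\eta=\frac{\epsilon^3}{5832B},\qquad \gamma=\frac{\epsilon^3}{5832Bm},\qquad \lambda=\frac{\epsilon^2}{324B},\qquad (K_\gamma)_{ij}=k_\psi(x_i,x_j)+\gamma m\,\mathbf 1[x_i=x_j]$$ (so $K_\gamma=K+\gamma mI$, with $K$ the Gram matrix, if the $x_i$ are pairwise distinct), let $\ell_i=(K_\gamma(K_\gamma+\eta mI)^{-1})_{ii}$ be the ridge leverage scores, and let $d=\mathrm{tr}(K_\gamma(K_\gamma+\eta mI)^{-1})=\sum_i\ell_i$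 be the $\eta$-effective dimension of $K_\gamma$. Selection map $\kappa$ (randomized, with an oversampling constant $c>0$): 1. (RLS-Nyström sampling) Select each index $i$ independently with probability $\min(1,\ c\,\ell_i\log_1(d/\delta))$. Let $I$ be the set of selected indices, $S$ the matrix with columns $e_i$, $i\in I$, and $\bar K_\gamma=K_\gamma S(S^TK_\gamma S)^{\dagger}S^TK_\gamma$, where $\dagger$ is the Moore–Penrose inverse. 2. Compute $\bar\alpha_\gamma=(\bar K_\gamma+\lambda mI)^{-1}Y$ with $Y=(y_1,\dots,y_m)^T$, and $\alpha^*=S(S^TK_\gamma S)^{\dagger}S^TK_\gamma\bar\alpha_\gamma$. 3. Output the sub-sample $(x_i,y_i)_{i\in I}$ and, as a binary string $b$, the numbers $\tilde\alpha^*_i$, $i\in I$, obtained by truncating $\alpha^*_i$ to precision $\epsilon/(4M|I|)$. Each $\tilde\alpha^*_i$ is written as a sign bit followed by the binary digits of an integer multiple of the precision, with one common number of digits for all $i\in I$. Reconstruction map $\rho$: from the sub-sample and $b$, output $$h_{\mathcal S}(x)=\mathrm{clip}_{0,1}\Big(\sum_{i\in I}\big(k_\psi(x_i,x)+\gamma m\,\mathbf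 1[x=x_i]\big)\tilde\alpha^*_i\Big)$$ (note that $\gamma m=\epsilon^3/(5832B)$ does not depend on the sample). The size of a compressed sample is $|I|+|b|$, where $|b|$ is the length of $b$. Theorem. There is a universal constant $c_0>0$ such that for every $c\ge c_0$ there is a constant $C>0$, depending only on $c$, with the following property. For all $\mathcal X,\psi,B,M,\epsilon,\delta$ as above, $(\kappa,\rho)$ is an $(\epsilon,\delta)$-approximate agnostic compression scheme for $H_\psi$ and the square loss, of size $$k=C\,d\,\log_1\!\Big(\frac d\delta\Big)\,\log_1\!\Big(\frac{\sqrt m\,B\,M\,d\,\log_1(d/\delta)}{\epsilon^4}\Big).$$ That is, for every $m$ and every sample $\mathcal S\in(\mathcal X\times[0,1])^m$, with probability at least $1-\delta$ over the random selection, both the compressed sample has size at most $k$ and $$\frac1m\sum_{i=1}^m(h_{\mathcal S}(x_i)-y_i)^2\ \le\ \frac1m\sum_{i=1}^m(h(x_i)-y_i)^2+\epsilon\qquad\text{for all }h\in H_\psi .$$ -/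

import Mathlib

noncomputable section

namespace KernelCompression

open scoped Matrix ENNReal

/-! ## Selection schemes and compression schemes -/

/-- A (randomized) selection scheme.  The selection map takes a sample to a random pair
consisting of a sub-sample and a finite binary string, the side information; the reconstruction
map turns such a pair into a hypothesis. -/
structure SelectionScheme (X Y Y' : Type*) where
  /-- the selection map `κ`; its value is the law of the random output -/
  select : {m : ℕ} → (Fin m → X × Y) → PMF (List (X × Y) × List Bool)
  /-- the reconstruction map `ρ` -/
  reconstruct : List (X × Y) × List Bool → X → Y'
  /-- the first component of the output of `κ` is a sub-sample of the input -/
  select_sublist : ∀ {m : ℕ} (s : Fin m → X × Y), ∀ z ∈ (select s).support,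
    z.1.Sublist (List.ofFn s)

/-- The size `|S'| + |b|` of a compressed sample. -/
def compressedSize {X Y : Type*} (z : List (X × Y) × List Bool) : ℕ :=
  z.1.length + z.2.length

/-- The average loss of `f` on a sample. -/
def avgLoss {X Y Y' : Type*} (l : Y' → Y → ℝ) (f : X → Y') {m : ℕ} (s : Fin m → X × Y) : ℝ :=
  (1 / (m : ℝ)) * ∑ i, l (f (s i).1) (s i).2

/-- `(κ, ρ)` is an `(ε, δ)`-approximate agnostic compression scheme of size `k` for the
hypothesis class `H`, the loss `l` and samples with property `P`: for every sample with
property `P`, with probability at least `1 - δ` over the random choices of `κ`, the compressed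
sample has size at most `k` and the average loss of the reconstructed hypothesis exceeds that
of no `h ∈ H` by more than `ε`. -/
def SelectionScheme.IsApproxAgnosticCompression {X Y Y' : Type*} (A : SelectionScheme X Y Y')
    (l : Y' → Y → ℝ) (ε δ : ℝ) (H : Set (X → Y'))
    (P : {m : ℕ} → (Fin m → X × Y) → Prop) (k : {m : ℕ} → (Fin m → X × Y) → ℝ) : Prop :=
  ∀ {m : ℕ} (s : Fin m → X × Y), P s →
    ENNReal.ofReal (1 - δ) ≤ (A.select s).toOuterMeasure
      {z | (compressedSize z : ℝ) ≤ k s ∧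
        ∀ h ∈ H, avgLoss l (A.reconstruct z) s ≤ avgLoss l h s + ε}

/-- Square loss, for labels in `[0, 1]`. -/
def squareLoss (y' : ℝ) (y : Set.Icc (0 : ℝ) 1) : ℝ := (y' - y) ^ 2

/-! ## Kernels, Gram matrices and effective dimension -/

/-- The kernel `k_ψ(x, x') = ⟨ψ(x), ψ(x')⟩` of the feature map `ψ`. -/
def featureKernel {X 𝒦 : Type*} [NormedAddCommGroup 𝒦] [InnerProductSpace ℝ 𝒦] (ψ : X → 𝒦)
    (x x' : X) : ℝ :=
  inner ℝ (ψ x) (ψ x')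

/-- The class `H_ψ` of functions `x ↦ ⟨v, ψ(x)⟩` with `⟨v, v⟩ ≤ B`. -/
def rkhsBall {X 𝒦 : Type*} [NormedAddCommGroup 𝒦] [InnerProductSpace ℝ 𝒦] (ψ : X → 𝒦)
    (B : ℝ) : Set (X → ℝ) :=
  {h | ∃ v : 𝒦, inner ℝ v v ≤ B ∧ h = fun x => inner ℝ v (ψ x)}

open Classical in
/-- The perturbed kernel `k(x, x') + r · 1[x = x']`. -/
def perturbedKernel {X : Type*} (k : X → X → ℝ) (r : ℝ) (x x' : X) : ℝ :=
  k x x' + if x = x' then r else 0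

/-- The matrix `K_γ` of the points `x₁, …, x_m`: the Gram matrix of the kernel perturbed by
`γ m · 1[x = x']`.  See `perturbedGram_of_injective`. -/
def perturbedGram {X : Type*} (k : X → X → ℝ) (γ : ℝ) {m : ℕ} (x : Fin m → X) :
    Matrix (Fin m) (Fin m) ℝ :=
  Matrix.of fun i j => perturbedKernel k (γ * m) (x i) (x j)

/-- For pairwise distinct points, `K_γ = K + γ m I`. -/
theorem perturbedGram_of_injective {X : Type*} (k : X → X → ℝ) (γ : ℝ) {m : ℕ} (x : Fin m → X)
    (hx : Function.Injective x) :
    perturbedGram k γ x =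
      (Matrix.of fun i j => k (x i) (x j)) + (γ * m) • (1 : Matrix (Fin m) (Fin m) ℝ) := by
  ext i j
  simp [perturbedGram, perturbedKernel, hx.eq_iff, Matrix.one_apply]

/-- The `η`-effective dimension `tr (K (K + η m I)⁻¹)`. -/
def effectiveDim {m : ℕ} (K : Matrix (Fin m) (Fin m) ℝ) (η : ℝ) : ℝ :=
  (K * (K + (η * m) • 1)⁻¹).trace

/-- The ridge leverage scores `(K (K + η m I)⁻¹)ᵢᵢ`; they add up to the effective dimension. -/
def ridgeLeverage {m : ℕ} (K : Matrix (Fin m) (Fin m) ℝ) (η : ℝ) (i : Fin m) : ℝ :=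
  (K * (K + (η * m) • 1)⁻¹) i i

/-- The logarithm truncated below at `1`. -/
def log₁ (t : ℝ) : ℝ := max 1 (Real.log t)

/-! ## The Moore–Penrose inverse -/

/-- The four Penrose equations for a real square matrix. -/
structure IsMoorePenrose {n : Type*} [Fintype n] (A X : Matrix n n ℝ) : Prop where
  mul_mul_left : A * X * A = A
  mul_mul_right : X * A * X = X
  symm_left : (A * X)ᵀ = A * X
  symm_right : (X * A)ᵀ = X * A

theorem IsMoorePenrose.unique {n : Type*} [Fintype n] {A X Z : Matrix n n ℝ}
    (hX : IsMoorePenrose A X) (hZ : IsMoorePenrose A Z) : X = Z := by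
  have h1 : A * X = A * Z := by
    calc A * X = (A * X)ᵀ := hX.symm_left.symm
      _ = ((A * Z) * (A * X))ᵀ := by
          rw [← Matrix.mul_assoc, hZ.mul_mul_left]
      _ = (A * X)ᵀ * (A * Z)ᵀ := Matrix.transpose_mul _ _
      _ = (A * X) * (A * Z) := by rw [hX.symm_left, hZ.symm_left]
      _ = A * Z := by rw [← Matrix.mul_assoc, hX.mul_mul_left]
  have h2 : X * A = Z * A := by
    calc X * A = (X * A)ᵀ := hX.symm_right.symm
      _ = ((X * A) * (Z * A))ᵀ := by
          rw [Matrix.mul_assoc, ← Matrix.mul_assoc A, hZ.mul_mul_left]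
      _ = (Z * A)ᵀ * (X * A)ᵀ := Matrix.transpose_mul _ _
      _ = (Z * A) * (X * A) := by rw [hX.symm_right, hZ.symm_right]
      _ = Z * A := by rw [Matrix.mul_assoc, ← Matrix.mul_assoc A, hX.mul_mul_left]
  calc X = X * A * X := hX.mul_mul_right.symm
    _ = Z * A * Z := by rw [h2, Matrix.mul_assoc, h1, ← Matrix.mul_assoc]
    _ = Z := hZ.mul_mul_right

theorem exists_isMoorePenrose {n : Type*} [Fintype n] {A : Matrix n n ℝ} (hA : A.IsHermitian) :
    ∃ X, IsMoorePenrose A X := by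
  classical
  obtain ⟨φ, d, hs⟩ : ∃ (φ : Matrix n n ℝ ≃⋆ₐ[ℝ] Matrix n n ℝ) (d : n → ℝ),
      A = φ (Matrix.diagonal d) :=
    ⟨Unitary.conjStarAlgAut ℝ (Matrix n n ℝ) hA.eigenvectorUnitary, hA.eigenvalues, by
      simpa using! hA.spectral_theorem⟩
  have key : ∀ d : n → ℝ, (φ (Matrix.diagonal d))ᵀ = φ (Matrix.diagonal d) := by
    intro d
    rw [← Matrix.conjTranspose_eq_transpose_of_trivial, ← Matrix.star_eq_conjTranspose,
      ← map_star, Matrix.star_eq_conjTranspose, Matrix.diagonal_conjTranspose]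
    simp
  have inv3 : ∀ t : ℝ, t⁻¹ * t * t⁻¹ = t⁻¹ := by
    intro t
    simpa using mul_inv_mul_cancel t⁻¹
  subst hs
  refine ⟨φ (Matrix.diagonal fun i => (d i)⁻¹), ?_, ?_, ?_, ?_⟩
  · rw [← map_mul, ← map_mul, Matrix.diagonal_mul_diagonal, Matrix.diagonal_mul_diagonal]
    simp
  · rw [← map_mul, ← map_mul, Matrix.diagonal_mul_diagonal, Matrix.diagonal_mul_diagonal]
    simp only [inv3]
  · rw [← map_mul, Matrix.diagonal_mul_diagonal, key]
  · rw [← map_mul, Matrix.diagonal_mul_diagonal, key]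

open Classical in
/-- The Moore–Penrose inverse `A†`. -/
def pinv {n : Type*} [Fintype n] (A : Matrix n n ℝ) : Matrix n n ℝ :=
  if h : ∃ X, IsMoorePenrose A X then h.choose else 0

theorem isMoorePenrose_pinv {n : Type*} [Fintype n] {A : Matrix n n ℝ} (hA : A.IsHermitian) :
    IsMoorePenrose A (pinv A) := by
  have h := exists_isMoorePenrose hA
  rw [pinv, dif_pos h]
  exact h.choose_spec

/-! ## RLS-Nyström sampling

Column `i` is selected, independently of the others, with probability
`min (1, c · ℓᵢ · log (d / δ))`, where `ℓᵢ` is its ridge leverage score and `d = ∑ ℓᵢ` the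
effective dimension.  A selection of columns is a function `ω : Fin m → Bool`. -/

/-- The probability with which column `i` is selected (the leverage scores of a positive
semidefinite matrix are nonnegative, so that the outer `max` is not active). -/
def rlsProb {m : ℕ} (K : Matrix (Fin m) (Fin m) ℝ) (η c δ : ℝ) (i : Fin m) : ℝ :=
  max 0 (min 1 (c * ridgeLeverage K η i * log₁ (effectiveDim K η / δ)))

theorem rlsProb_nonneg {m : ℕ} (K : Matrix (Fin m) (Fin m) ℝ) (η c δ : ℝ) (i : Fin m) :
    0 ≤ rlsProb K η c δ i := le_max_left _ _

theorem rlsProb_le_one {m : ℕ} (K : Matrix (Fin m) (Fin m) ℝ) (η c δ : ℝ) (i : Fin m) :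
    rlsProb K η c δ i ≤ 1 := max_le zero_le_one (min_le_left _ _)

/-- The law of the selected set of columns: a product of Bernoulli laws. -/
def rlsSampling {m : ℕ} (K : Matrix (Fin m) (Fin m) ℝ) (η c δ : ℝ) : PMF (Fin m → Bool) :=
  PMF.ofFintype
    (fun ω => ∏ i, if ω i then ENNReal.ofReal (rlsProb K η c δ i)
      else ENNReal.ofReal (1 - rlsProb K η c δ i)) (by
    have h := Finset.prod_univ_sum (fun _ : Fin m => (Finset.univ : Finset Bool))
      (fun i b => if b then ENNReal.ofReal (rlsProb K η c δ i)
        else ENNReal.ofReal (1 - rlsProb K η c δ i))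
    rw [Fintype.piFinset_univ] at h
    rw [← h]
    refine Finset.prod_eq_one fun i _ => ?_
    simp only [Fintype.sum_bool, if_true, Bool.false_eq_true, if_false]
    rw [← ENNReal.ofReal_add (rlsProb_nonneg K η c δ i)
      (sub_nonneg.2 (rlsProb_le_one K η c δ i))]
    simp)

/-- The matrix `S` whose columns are the basis vectors `e_i` of the selected indices. -/
def selectionMatrix {m : ℕ} (ω : Fin m → Bool) : Matrix (Fin m) {i : Fin m // ω i = true} ℝ :=
  (1 : Matrix (Fin m) (Fin m) ℝ).submatrix id Subtype.val

/-- The matrix `S (Sᵀ K S)† Sᵀ K`. -/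
def sparsifier {m : ℕ} (K : Matrix (Fin m) (Fin m) ℝ) (ω : Fin m → Bool) :
    Matrix (Fin m) (Fin m) ℝ :=
  selectionMatrix ω * pinv ((selectionMatrix ω)ᵀ * K * selectionMatrix ω) *
    (selectionMatrix ω)ᵀ * K

/-- The Nyström approximation `K̄ = K S (Sᵀ K S)† Sᵀ K`. -/
def nystrom {m : ℕ} (K : Matrix (Fin m) (Fin m) ℝ) (ω : Fin m → Bool) :
    Matrix (Fin m) (Fin m) ℝ :=
  K * sparsifier K ω

/-- The solution `ᾱ = (K̄ + lam m I)⁻¹ Y` of the regularized problem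
`minimize (1/m) ‖K̄ α - Y‖² + lam αᵀ K̄ α`. -/
def ridgeSolution {m : ℕ} (K : Matrix (Fin m) (Fin m) ℝ) (ω : Fin m → Bool) (lam : ℝ)
    (Y : Fin m → ℝ) : Fin m → ℝ :=
  (nystrom K ω + (lam * m) • 1)⁻¹ *ᵥ Y

/-- The sparse vector `α* = S (Sᵀ K S)† Sᵀ K ᾱ`. -/
def sparseSolution {m : ℕ} (K : Matrix (Fin m) (Fin m) ℝ) (ω : Fin m → Bool) (lam : ℝ)
    (Y : Fin m → ℝ) : Fin m → ℝ :=
  sparsifier K ω *ᵥ ridgeSolution K ω lam Y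

/-! ## Binary encoding of the truncated coefficients

All coefficients are encoded with one common number of bits, one sign bit followed by the
binary digits of the absolute value, least significant digit first. -/

/-- `a / τ` rounded towards zero: `a` truncated to precision `τ` is `truncate τ a * τ`. -/
def truncate (τ a : ℝ) : ℤ := if 0 ≤ a then ⌊a / τ⌋ else ⌈a / τ⌉

/-- One sign bit and the `w` lowest binary digits of `|q|`. -/
def encodeInt (w : ℕ) (q : ℤ) : List Bool :=
  decide (q < 0) :: (List.range w).map fun i => q.natAbs.testBit i

/-- The natural number with the given binary digits, least significant first. -/
def bitsToNat : List Bool → ℕ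
  | [] => 0
  | b :: bs => b.toNat + 2 * bitsToNat bs

/-- The inverse of `encodeInt`. -/
def decodeInt : List Bool → ℤ
  | [] => 0
  | s :: bs => (if s then -1 else 1) * (bitsToNat bs : ℤ)

theorem bitsToNat_testBit (w n : ℕ) :
    bitsToNat ((List.range w).map fun i => n.testBit i) = n % 2 ^ w := by
  induction w generalizing n with
  | zero => simp [bitsToNat, Nat.mod_one]
  | succ w ih =>
    rw [List.range_succ_eq_map, List.map_cons, List.map_map]
    have h : ((fun i => n.testBit i) ∘ Nat.succ) = fun i => (n / 2).testBit i := by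
      funext i
      simp [Nat.testBit_succ]
    rw [h, bitsToNat, ih, Nat.testBit_zero, pow_succ', Nat.mod_mul]
    rcases Nat.mod_two_eq_zero_or_one n with h0 | h0 <;> simp [h0]

theorem decodeInt_encodeInt (w : ℕ) (q : ℤ) (hq : q.natAbs < 2 ^ w) :
    decodeInt (encodeInt w q) = q := by
  rw [encodeInt, decodeInt, bitsToNat_testBit, Nat.mod_eq_of_lt hq]
  by_cases h : q < 0
  · rw [decide_eq_true h, if_pos rfl]
    omega
  · rw [decide_eq_false h, if_neg Bool.false_ne_true]
    omega

/-- The number of digits needed for all entries of a list of integers. -/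
def commonWidth (l : List ℤ) : ℕ := (l.map fun q => q.natAbs.size).foldr max 0

/-- The binary string that encodes a list of integers. -/
def encodeList (l : List ℤ) : List Bool := l.flatMap (encodeInt (commonWidth l))

/-- The `j`-th integer of a list of `n` integers encoded by the string `b`, which consists of
`n` blocks of equal length. -/
def decodeEntry (n : ℕ) (b : List Bool) (j : ℕ) : ℤ :=
  decodeInt ((b.drop (j * (b.length / n))).take (b.length / n))

/-! ## The compression scheme -/

/-- `η = ε³ / (5832 B)`. -/
def etaParam (ε B : ℝ) : ℝ := ε ^ 3 / (5832 * B)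

/-- `γ = ε³ / (5832 B m)`. -/
def gammaParam (ε B : ℝ) (m : ℕ) : ℝ := ε ^ 3 / (5832 * B * m)

/-- `λ = ε² / (324 B)`. -/
def lambdaParam (ε B : ℝ) : ℝ := ε ^ 2 / (324 * B)

/-- The precision `ε / (4 M n)` for `n` coefficients. -/
def precision (ε M : ℝ) (n : ℕ) : ℝ := ε / (4 * M * n)

/-- `clip_{0,1}`. -/
def clip01 (t : ℝ) : ℝ := max 0 (min 1 t)

/-- The matrix `K_γ` of a sample, for `γ = ε³ / (5832 B m)`. -/
def sampleGram {X : Type*} (k : X → X → ℝ) (ε B : ℝ) {m : ℕ}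
    (s : Fin m → X × Set.Icc (0 : ℝ) 1) : Matrix (Fin m) (Fin m) ℝ :=
  perturbedGram k (gammaParam ε B m) fun i => (s i).1

/-- The effective dimension `d = d_η(K_γ)` of a sample, for `η = ε³ / (5832 B)` and
`γ = ε³ / (5832 B m)`. -/
def sampleDim {X : Type*} (k : X → X → ℝ) (ε B : ℝ) {m : ℕ}
    (s : Fin m → X × Set.Icc (0 : ℝ) 1) : ℝ :=
  effectiveDim (sampleGram k ε B s) (etaParam ε B)

/-- The selected indices in increasing order. -/
def selectedIndices {m : ℕ} (ω : Fin m → Bool) : List (Fin m) :=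
  (List.finRange m).filter fun i => ω i

/-- The output of the selection map, given the selected columns `ω`: the sub-sample of the
selected indices, and the encoding of the entries of `α*` at these indices, truncated to
precision `ε / (4 M |I|)`. -/
def compressWith {X : Type*} (k : X → X → ℝ) (ε B M : ℝ) {m : ℕ}
    (s : Fin m → X × Set.Icc (0 : ℝ) 1) (ω : Fin m → Bool) :
    List (X × Set.Icc (0 : ℝ) 1) × List Bool :=
  ((selectedIndices ω).map s,
    encodeList ((selectedIndices ω).map fun i =>
      truncate (precision ε M (selectedIndices ω).length)
        (sparseSolution (sampleGram k ε B s) ω (lambdaParam ε B) (fun j => ((s j).2 : ℝ)) i)))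

/-- The reconstruction map: `x ↦ clip_{0,1} (∑_{j ∈ I} (k(x_j, x) + γ m 1[x = x_j]) α̃_j)`.
Here `γ m = ε³ / (5832 B)`. -/
def reconstructWith {X : Type*} (k : X → X → ℝ) (ε B M : ℝ)
    (z : List (X × Set.Icc (0 : ℝ) 1) × List Bool) (x : X) : ℝ :=
  clip01 (∑ j : Fin z.1.length,
    perturbedKernel k (ε ^ 3 / (5832 * B)) (z.1.get j).1 x *
      ((decodeEntry z.1.length z.2 j : ℝ) * precision ε M z.1.length))

/-- The Nyström-based selection scheme `(κ, ρ)` for the kernel `k` with oversampling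
constant `c`. -/
def nystromScheme {X : Type*} (k : X → X → ℝ) (c ε δ B M : ℝ) :
    SelectionScheme X (Set.Icc (0 : ℝ) 1) ℝ where
  select s := (rlsSampling (sampleGram k ε B s) (etaParam ε B) c δ).map
    (compressWith k ε B M s)
  reconstruct := reconstructWith k ε B M
  select_sublist := by
    intro m s z hz
    rw [PMF.support_map] at hz
    obtain ⟨ω, -, rfl⟩ := hz
    rw [List.ofFn_eq_map]
    exact List.filter_sublist.map s

end KernelCompression

end

universe u v

/-! Sampling. With `μ = η m`, the matrix `A (A + μ)⁻¹` is the Gram matrix of vectors `vᵢ` with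
`|vᵢ|² = ℓᵢ`, and every `z` yields a vector `x` with `vᵢ · x = (A z)ᵢ` and `|x|² = |A z|² + μ z·Az`.
If the reweighted sum of `vᵢ vᵢᵀ` over the selected indices does not fall far below its mean, then
`A z` cannot vanish on all selected indices unless `|A z|² ≤ (μ/2) z·Az` (`IsGoodSelection`). The
failure probability comes from a matrix Chernoff bound, `sum_bernoulliWeight_quadratic_lt`. The
random rank one terms are replaced by deterministic ones, one at a time, inside `tr exp`. Each
replacement needs only Klein's inequality (`trace_exp_add_ge`) and the estimate `v·exp(H - r v vᵀ)v
≥ exp(-r|v|²) v·exp(H)v` (`exp_sub_vecMulVec_ge`), not the Golden–Thompson inequality or Lieb's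
theorem. Measuring the deviation by `tr (exp H - H - 1)` makes the bound proportional to `∑ ℓᵢ = d`
instead of `m`. A scalar Chernoff bound controls the number of selected columns.

Regression. The Nyström matrix is the `A`-orthogonal projection of `A` onto the selected columns, so
a good selection gives `K̄ ≤ A ≤ K̄ + μ/2` as quadratic forms (`IsGoodSelection.dotProduct_le`). A
duality argument (`dotProduct_sub_ridge_le`) then bounds the training error of ridge regression with
`K̄` by `(1 + η/(2λ)) (loss h + λ B)`, on average. The parameters make the excess over the loss of
`h` at most `ε/4` in the nontrivial case, where `ε` and that loss are below `1`. Truncation costs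
another `3ε/4`.

Bits. Since `γ m = η`, the matrix `A` is `K + η · 1[xᵢ = xⱼ]`. For distinct points this is at least
`η I`, so the coefficients are at most `√m / η` and `d` is bounded below. Repeated points make `A`
singular. The same conclusions survive because the Moore–Penrose inverse gives equal coefficients to
selected copies of a point (`sparsifier_mulVec_eq`). -/

noncomputable section

namespace KernelCompression

open scoped Matrix ENNReal

/-! ## Quadratic forms and traces of matrix exponentials -/

section Spectral

variable {n : Type*} [Fintype n] [DecidableEq n]

/-- An orthonormal family of eigenvectors of `H`, with its eigenvalues, together with the
resulting formulas for traces and quadratic forms. -/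
structure IsEigenfamily (H : Matrix n n ℝ) (u : n → n → ℝ) (l : n → ℝ) : Prop where
  norm_one : ∀ k, u k ⬝ᵥ u k = 1
  parseval : ∀ v, ∑ k, (u k ⬝ᵥ v) ^ 2 = v ⬝ᵥ v
  trace_eq : ∀ N : Matrix n n ℝ, N.trace = ∑ k, u k ⬝ᵥ N *ᵥ u k
  mulVec_eq : ∀ k, H *ᵥ u k = l k • u k
  pow_quad : ∀ v (j : ℕ), v ⬝ᵥ (H ^ j) *ᵥ v = ∑ k, l k ^ j * (u k ⬝ᵥ v) ^ 2
  exp_quad : ∀ v, v ⬝ᵥ NormedSpace.exp H *ᵥ v = ∑ k, Real.exp (l k) * (u k ⬝ᵥ v) ^ 2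
  exp_trace : (NormedSpace.exp H).trace = ∑ k, Real.exp (l k)

theorem dotProduct_conj_diagonal (U : Matrix n n ℝ) (g v : n → ℝ) :
    v ⬝ᵥ (U * Matrix.diagonal g * Uᵀ) *ᵥ v = ∑ k, g k * (Uᵀ k ⬝ᵥ v) ^ 2 := by
  rw [← Matrix.mulVec_mulVec, ← Matrix.mulVec_mulVec, Matrix.dotProduct_mulVec,
    ← Matrix.mulVec_transpose, dotProduct]
  refine Finset.sum_congr rfl fun k _ => ?_
  rw [Matrix.mulVec_diagonal]
  simp only [Matrix.mulVec]
  ring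

theorem exists_isEigenfamily {H : Matrix n n ℝ} (hH : H.IsHermitian) :
    ∃ u l, IsEigenfamily H u l := by
  obtain ⟨U, l, hU, hU', hs⟩ : ∃ (U : Matrix n n ℝ) (l : n → ℝ), Uᵀ * U = 1 ∧ U * Uᵀ = 1 ∧
      H = U * Matrix.diagonal l * Uᵀ := by
    refine ⟨hH.eigenvectorUnitary, hH.eigenvalues, ?_, ?_, ?_⟩
    · have := Unitary.coe_star_mul_self hH.eigenvectorUnitary
      rwa [Matrix.star_eq_conjTranspose, Matrix.conjTranspose_eq_transpose_of_trivial] at this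
    · have := Unitary.coe_mul_star_self hH.eigenvectorUnitary
      rwa [Unitary.coe_star, Matrix.star_eq_conjTranspose,
        Matrix.conjTranspose_eq_transpose_of_trivial] at this
    · have h := hH.spectral_theorem
      rw [Unitary.conjStarAlgAut_apply, Matrix.star_eq_conjTranspose,
        Matrix.conjTranspose_eq_transpose_of_trivial] at h
      simpa [Function.comp_def] using h
  have hinv : U⁻¹ = Uᵀ := Matrix.inv_eq_left_inv hU
  have hunit : IsUnit U := ⟨⟨U, Uᵀ, hU', hU⟩, rfl⟩
  have hexp : NormedSpace.exp H = U * Matrix.diagonal (fun k => Real.exp (l k)) * Uᵀ := by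
    rw [hs, ← hinv, Matrix.exp_conj _ _ hunit, Matrix.exp_diagonal]
    congr 3
    ext k
    rw [Pi.coe_exp, Real.exp_eq_exp_ℝ]
  have hpow : ∀ j : ℕ, H ^ j = U * Matrix.diagonal (fun k => l k ^ j) * Uᵀ := by
    intro j
    induction j with
    | zero => simp [hU', hs]
    | succ j ih =>
      rw [pow_succ, ih]
      conv_lhs => rw [hs]
      calc U * Matrix.diagonal (fun k => l k ^ j) * Uᵀ * (U * Matrix.diagonal l * Uᵀ)
          = U * Matrix.diagonal (fun k => l k ^ j) * (Uᵀ * U) * Matrix.diagonal l * Uᵀ := by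
            simp only [Matrix.mul_assoc]
        _ = _ := by
            rw [hU, Matrix.mul_one, Matrix.mul_assoc U, Matrix.diagonal_mul_diagonal]
            simp only [pow_succ]
  have horth : ∀ k, Uᵀ k ⬝ᵥ Uᵀ k = 1 := by
    intro k
    have := congrFun (congrFun hU k) k
    rw [Matrix.mul_apply, Matrix.one_apply_eq] at this
    simpa [dotProduct] using this
  refine ⟨Uᵀ, l, horth, fun v => ?_, fun N => ?_, fun k => ?_, fun v j => ?_, fun v => ?_, ?_⟩
  · have := dotProduct_conj_diagonal U (fun _ => 1) v
    rw [Matrix.diagonal_one, Matrix.mul_one, hU', Matrix.one_mulVec] at this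
    simpa using this.symm
  · have : N.trace = (Uᵀ * N * U).trace := by
      rw [Matrix.trace_mul_comm, ← Matrix.mul_assoc, hU', Matrix.one_mul]
    rw [this, Matrix.trace]
    refine Finset.sum_congr rfl fun k _ => ?_
    rw [Matrix.diag_apply, Matrix.mul_assoc, Matrix.mul_apply']
    congr 1
  · have h : H * U = U * Matrix.diagonal l := by
      rw [hs, Matrix.mul_assoc, hU, Matrix.mul_one]
    ext i
    have := congrFun (congrFun h i) k
    rw [Matrix.mul_diagonal, Matrix.mul_apply'] at this
    simp only [Matrix.mulVec, Pi.smul_apply, smul_eq_mul, Matrix.transpose_apply]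
    rw [mul_comm]
    exact this
  · rw [hpow, dotProduct_conj_diagonal]
  · rw [hexp, dotProduct_conj_diagonal]
  · rw [hexp, Matrix.trace_mul_comm, ← Matrix.mul_assoc, hU, Matrix.one_mul,
      Matrix.trace_diagonal]

/-- Reduces a comparison of quadratic forms of exponentials to a comparison of the moments `v · Hʲ
v`. -/
theorem hasSum_dotProduct_exp {H : Matrix n n ℝ} (hH : H.IsHermitian) (v : n → ℝ) :
    HasSum (fun j : ℕ => ((Nat.factorial j : ℕ) : ℝ)⁻¹ * (v ⬝ᵥ (H ^ j) *ᵥ v))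
      (v ⬝ᵥ NormedSpace.exp H *ᵥ v) := by
  obtain ⟨u, l, h⟩ := exists_isEigenfamily hH
  rw [h.exp_quad]
  simp only [h.pow_quad, Finset.mul_sum]
  refine hasSum_sum fun k _ => ?_
  have := (NormedSpace.expSeries_div_hasSum_exp (l k)).mul_right ((u k ⬝ᵥ v) ^ 2)
  rw [← Real.exp_eq_exp_ℝ] at this
  simpa only [div_eq_inv_mul, mul_assoc] using this

theorem dotProduct_exp_nonneg {H : Matrix n n ℝ} (hH : H.IsHermitian) (v : n → ℝ) :
    0 ≤ v ⬝ᵥ NormedSpace.exp H *ᵥ v := by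
  obtain ⟨u, l, h⟩ := exists_isEigenfamily hH
  rw [h.exp_quad]
  positivity

/-- The tangent line inequality for the quadratic form of an exponential. -/
theorem dotProduct_exp_ge {H : Matrix n n ℝ} (hH : H.IsHermitian) (v : n → ℝ) (c : ℝ) :
    Real.exp c * ((1 - c) * (v ⬝ᵥ v) + v ⬝ᵥ H *ᵥ v) ≤ v ⬝ᵥ NormedSpace.exp H *ᵥ v := by
  obtain ⟨u, l, h⟩ := exists_isEigenfamily hH
  have h1 := h.pow_quad v 1
  rw [pow_one] at h1
  rw [h.exp_quad, h1, ← h.parseval, Finset.mul_sum, ← Finset.sum_add_distrib, Finset.mul_sum]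
  refine Finset.sum_le_sum fun k _ => ?_
  have h2 : Real.exp c * (1 + (l k - c)) ≤ Real.exp (l k) := by
    have := Real.add_one_le_exp (l k - c)
    calc Real.exp c * (1 + (l k - c)) ≤ Real.exp c * Real.exp (l k - c) := by gcongr; linarith
      _ = Real.exp (l k) := by rw [← Real.exp_add]; ring_nf
  nlinarith [mul_le_mul_of_nonneg_right h2 (sq_nonneg (u k ⬝ᵥ v))]

theorem isHermitian_add_smul_vecMulVec {n : Type*} {H : Matrix n n ℝ} (hH : H.IsHermitian) (r : ℝ)
    (v : n → ℝ) : (H + r • Matrix.vecMulVec v v).IsHermitian := by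
  refine hH.add ?_
  ext i j
  simp [Matrix.vecMulVec_apply, mul_comm]

theorem dotProduct_vecMulVec_mulVec {n : Type*} [Fintype n] (v x y : n → ℝ) :
    x ⬝ᵥ Matrix.vecMulVec v v *ᵥ y = (x ⬝ᵥ v) * (v ⬝ᵥ y) := by
  rw [Matrix.vecMulVec_mulVec]
  simp [dotProduct_smul, mul_comm]

/-- Klein's inequality for the exponential and a rank one perturbation. -/
theorem trace_exp_add_ge {H : Matrix n n ℝ} (hH : H.IsHermitian) (r : ℝ) (v : n → ℝ) :
    (NormedSpace.exp H).trace + r * (v ⬝ᵥ NormedSpace.exp H *ᵥ v) ≤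
      (NormedSpace.exp (H + r • Matrix.vecMulVec v v)).trace := by
  obtain ⟨u, l, h⟩ := exists_isEigenfamily hH
  -- All traces are computed in the eigenbasis of the unperturbed `H`. The claim then holds term by
  -- term, by the tangent line at the eigenvalue `l k`.
  rw [h.exp_trace, h.exp_quad, h.trace_eq (NormedSpace.exp (H + _)), Finset.mul_sum,
    ← Finset.sum_add_distrib]
  refine Finset.sum_le_sum fun k _ => ?_
  refine le_trans (le_of_eq ?_)
    (dotProduct_exp_ge (isHermitian_add_smul_vecMulVec hH r v) (u k) (l k))
  rw [Matrix.add_mulVec, dotProduct_add, h.mulVec_eq, dotProduct_smul, h.norm_one,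
    Matrix.smul_mulVec, dotProduct_smul, dotProduct_vecMulVec_mulVec, dotProduct_comm v]
  simp only [smul_eq_mul]
  ring

/-- For a positive semidefinite `N` and a unit vector `v`, the moments `v · Nʲ v` grow when a
nonnegative multiple of the projection onto the orthogonal complement of `v` is added to `N`. -/
theorem dotProduct_pow_le_of_unit {N : Matrix n n ℝ} (hN : N.PosSemidef) {v : n → ℝ}
    (hv : v ⬝ᵥ v = 1) {r : ℝ} (hr : 0 ≤ r) (j : ℕ) :
    v ⬝ᵥ (N ^ j) *ᵥ v ≤ v ⬝ᵥ ((N + r • (1 - Matrix.vecMulVec v v)) ^ j) *ᵥ v := by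
  set P : Matrix n n ℝ := 1 - Matrix.vecMulVec v v with hP
  have hPT : Pᵀ = P := by
    ext a b
    simp [hP, Matrix.vecMulVec_apply, Matrix.one_apply, mul_comm, eq_comm]
  have hNT : Nᵀ = N := by
    rw [← Matrix.conjTranspose_eq_transpose_of_trivial]
    exact hN.isHermitian
  have hPx : ∀ x, P *ᵥ x = x - (v ⬝ᵥ x) • v := by
    intro x
    rw [hP, Matrix.sub_mulVec, Matrix.one_mulVec, Matrix.vecMulVec_mulVec]
    simp
  have hPv : P *ᵥ v = 0 := by rw [hPx, hv]; simp
  set T : Matrix n n ℝ := P * N * P with hT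
  set w : n → ℝ := P *ᵥ (N *ᵥ v) with hw
  set a : ℝ := v ⬝ᵥ N *ᵥ v with ha
  have hTpsd : T.PosSemidef := by
    have := hN.conjTranspose_mul_mul_same P
    rwa [Matrix.conjTranspose_eq_transpose_of_trivial, hPT] at this
  have ha0 : 0 ≤ a := by simpa using hN.dotProduct_mulVec_nonneg v
  have hsymm : ∀ x y : n → ℝ, x ⬝ᵥ N *ᵥ y = N *ᵥ x ⬝ᵥ y := by
    intro x y
    rw [Matrix.dotProduct_mulVec, ← Matrix.mulVec_transpose, hNT]
  have hNv : N *ᵥ v = a • v + w := by rw [hw, hPx]; simp [ha]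
  have hvw : v ⬝ᵥ w = 0 := by
    rw [hw, hPx, dotProduct_sub, dotProduct_smul, hv]
    simp
  have hTv : T *ᵥ v = 0 := by
    rw [hT, ← Matrix.mulVec_mulVec, hPv, Matrix.mulVec_zero]
  have hwTv : ∀ i : ℕ, w ⬝ᵥ (T ^ i) *ᵥ v = 0 := by
    intro i
    cases i with
    | zero => simpa [dotProduct_comm] using hvw
    | succ i => rw [pow_succ, ← Matrix.mulVec_mulVec, hTv]; simp
  have hwTw : ∀ i : ℕ, 0 ≤ w ⬝ᵥ (T ^ i) *ᵥ w := by
    intro i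
    simpa using (hTpsd.pow i).dotProduct_mulVec_nonneg w
  have hNx : ∀ x, N *ᵥ x = (a * (v ⬝ᵥ x) + w ⬝ᵥ x) • v + (v ⬝ᵥ x) • w + T *ᵥ x := by
    intro x
    have h1 : v ⬝ᵥ N *ᵥ x = a * (v ⬝ᵥ x) + w ⬝ᵥ x := by
      rw [hsymm, hNv, add_dotProduct, smul_dotProduct, smul_eq_mul]
    have h2 : P *ᵥ (N *ᵥ x) = (v ⬝ᵥ x) • w + T *ᵥ x := by
      rw [hT, ← Matrix.mulVec_mulVec, ← Matrix.mulVec_mulVec, hPx x, Matrix.mulVec_sub,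
        Matrix.mulVec_sub, Matrix.mulVec_smul, Matrix.mulVec_smul, hw]
      abel
    rw [add_assoc, ← h2, hPx, h1]
    abel
  -- In the splitting along `v` and its complement, `N` has the blocks `a`, `w`, `T`. The convex
  -- cone `C` contains `v` and is preserved by both `N` and `r P`.
  let C : (n → ℝ) → Prop := fun x => 0 ≤ v ⬝ᵥ x ∧ ∀ i : ℕ, 0 ≤ w ⬝ᵥ (T ^ i) *ᵥ x
  have hCN : ∀ x, C x → C (N *ᵥ x) := by
    rintro x ⟨h1, h2⟩
    have h20 := h2 0
    rw [pow_zero, Matrix.one_mulVec] at h20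
    constructor
    · rw [hsymm, hNv, add_dotProduct, smul_dotProduct, smul_eq_mul]
      positivity
    · intro i
      rw [hNx, Matrix.mulVec_add, Matrix.mulVec_add, Matrix.mulVec_smul, Matrix.mulVec_smul,
        Matrix.mulVec_mulVec x (T ^ i) T, ← pow_succ, dotProduct_add, dotProduct_add, dotProduct_smul,
        dotProduct_smul, hwTv]
      have := mul_nonneg h1 (hwTw i)
      have := h2 (i + 1)
      simp only [smul_eq_mul]
      linarith
  have hCP : ∀ x, C x → C ((r • P) *ᵥ x) := by
    rintro x ⟨h1, h2⟩
    constructor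
    · rw [Matrix.smul_mulVec, hPx, dotProduct_smul, dotProduct_sub, dotProduct_smul, hv]
      simp
    · intro i
      rw [Matrix.smul_mulVec, hPx, Matrix.mulVec_smul, Matrix.mulVec_sub, Matrix.mulVec_smul,
        dotProduct_smul, dotProduct_sub, dotProduct_smul, hwTv]
      simpa using mul_nonneg hr (h2 i)
  have hCadd : ∀ x y, C x → C y → C (x + y) := by
    rintro x y ⟨h1, h2⟩ ⟨h3, h4⟩
    refine ⟨by rw [dotProduct_add]; positivity, fun i => ?_⟩
    rw [Matrix.mulVec_add, dotProduct_add]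
    exact add_nonneg (h2 i) (h4 i)
  -- The difference of the two orbits stays in the cone as well, and pairing it with `v` gives the
  -- claim.
  have key : ∀ j : ℕ, C (((N + r • P) ^ j) *ᵥ v) ∧
      C (((N + r • P) ^ j) *ᵥ v - (N ^ j) *ᵥ v) := by
    intro j
    induction j with
    | zero =>
      refine ⟨⟨by simp [hv], fun i => ?_⟩, by simp [C]⟩
      rw [pow_zero, Matrix.one_mulVec, hwTv]
    | succ j ih =>
      have e : ((N + r • P) ^ (j + 1)) *ᵥ v = N *ᵥ (((N + r • P) ^ j) *ᵥ v) +
          (r • P) *ᵥ (((N + r • P) ^ j) *ᵥ v) := by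
        rw [pow_succ', ← Matrix.mulVec_mulVec, Matrix.add_mulVec]
      have e' : ((N + r • P) ^ (j + 1)) *ᵥ v - (N ^ (j + 1)) *ᵥ v =
          N *ᵥ (((N + r • P) ^ j) *ᵥ v - (N ^ j) *ᵥ v) +
          (r • P) *ᵥ (((N + r • P) ^ j) *ᵥ v) := by
        rw [e, pow_succ' N, ← Matrix.mulVec_mulVec, Matrix.mulVec_sub]
        abel
      exact ⟨by rw [e]; exact hCadd _ _ (hCN _ ih.1) (hCP _ ih.1),
        by rw [e']; exact hCadd _ _ (hCN _ ih.2) (hCP _ ih.1)⟩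
  have := (key j).2.1
  rw [dotProduct_sub] at this
  linarith

theorem exp_add_smul_one (H : Matrix n n ℝ) (c : ℝ) :
    NormedSpace.exp (H + c • (1 : Matrix n n ℝ)) = Real.exp c • NormedSpace.exp H := by
  rw [Matrix.exp_add_of_commute _ _ ((Commute.one_right H).smul_right c),
    Matrix.smul_one_eq_diagonal, Matrix.exp_diagonal]
  have : NormedSpace.exp (fun _ : n => c) = fun _ => Real.exp c := by
    ext k
    rw [Pi.coe_exp, Real.exp_eq_exp_ℝ]
  rw [this, ← Matrix.smul_one_eq_diagonal, Matrix.mul_smul, Matrix.mul_one]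

theorem exists_posSemidef_add_smul_one {H : Matrix n n ℝ} (hH : H.IsHermitian) :
    ∃ c : ℝ, (H + c • (1 : Matrix n n ℝ)).PosSemidef := by
  obtain ⟨u, l, h⟩ := exists_isEigenfamily hH
  refine ⟨∑ k, |l k|, Matrix.PosSemidef.of_dotProduct_mulVec_nonneg ?_ fun x => ?_⟩
  · refine hH.add ?_
    ext i j
    simp [Matrix.one_apply, eq_comm]
  · have h1 := h.pow_quad x 1
    rw [pow_one] at h1
    rw [star_trivial, Matrix.add_mulVec, dotProduct_add, h1, Matrix.smul_mulVec,
      Matrix.one_mulVec, dotProduct_smul, ← h.parseval x, smul_eq_mul, Finset.mul_sum,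
      ← Finset.sum_add_distrib]
    refine Finset.sum_nonneg fun k _ => ?_
    have h2 : |l k| ≤ ∑ k, |l k| := Finset.single_le_sum (f := fun k => |l k|)
      (fun i _ => abs_nonneg _) (Finset.mem_univ k)
    have h3 := neg_abs_le (l k)
    nlinarith [sq_nonneg (u k ⬝ᵥ x)]

/-- Subtracting `r v vᵀ` is the same as adding `r (1 - v vᵀ)` and subtracting `r I`. The scalar part
produces the factor `exp (-r)`, and the projection part does not decrease any moment once `H` has
been shifted to be positive semidefinite. -/
theorem exp_sub_vecMulVec_ge_of_unit {H : Matrix n n ℝ} (hH : H.IsHermitian) {v : n → ℝ}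
    (hv : v ⬝ᵥ v = 1) {r : ℝ} (hr : 0 ≤ r) :
    Real.exp (-r) * (v ⬝ᵥ NormedSpace.exp H *ᵥ v) ≤
      v ⬝ᵥ NormedSpace.exp (H + (-r) • Matrix.vecMulVec v v) *ᵥ v := by
  obtain ⟨c, hc⟩ := exists_posSemidef_add_smul_one hH
  set N := H + c • (1 : Matrix n n ℝ) with hN
  have e1 : H = N + (-c) • (1 : Matrix n n ℝ) := by rw [hN]; module
  have e2 : H + (-r) • Matrix.vecMulVec v v =
      (N + r • (1 - Matrix.vecMulVec v v)) + (-c + -r) • (1 : Matrix n n ℝ) := by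
    rw [hN]; module
  have hN2 : (N + r • (1 - Matrix.vecMulVec v v)).IsHermitian := by
    refine hc.isHermitian.add ?_
    ext i j
    simp [Matrix.vecMulVec_apply, Matrix.one_apply, mul_comm, eq_comm]
  rw [e2, exp_add_smul_one, e1, exp_add_smul_one, Matrix.smul_mulVec, Matrix.smul_mulVec,
    dotProduct_smul, dotProduct_smul, smul_eq_mul, smul_eq_mul, ← mul_assoc, ← Real.exp_add,
    add_comm (-r)]
  refine mul_le_mul_of_nonneg_left ?_ (Real.exp_pos _).le
  refine hasSum_le (fun j => ?_) (hasSum_dotProduct_exp hc.isHermitian v)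
    (hasSum_dotProduct_exp hN2 v)
  exact mul_le_mul_of_nonneg_left (dotProduct_pow_le_of_unit hc hv hr j) (by positivity)

/-- Subtracting `r v vᵀ` from `H` decreases `v · exp(H) v` at most by the factor
`exp (-r |v|²)`. -/
theorem exp_sub_vecMulVec_ge {H : Matrix n n ℝ} (hH : H.IsHermitian) (v : n → ℝ) {r : ℝ}
    (hr : 0 ≤ r) :
    Real.exp (-(r * (v ⬝ᵥ v))) * (v ⬝ᵥ NormedSpace.exp H *ᵥ v) ≤
      v ⬝ᵥ NormedSpace.exp (H + (-r) • Matrix.vecMulVec v v) *ᵥ v := by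
  by_cases h0 : v = 0
  · simp [h0]
  have hpos : 0 < v ⬝ᵥ v := by
    have := Matrix.dotProduct_star_self_pos_iff.2 h0
    simpa using this
  set q := √(v ⬝ᵥ v) with hq
  have hq0 : 0 < q := Real.sqrt_pos.2 hpos
  have hqq : q * q = v ⬝ᵥ v := Real.mul_self_sqrt hpos.le
  clear_value q
  obtain ⟨u, rfl⟩ : ∃ u, v = q • u :=
    ⟨q⁻¹ • v, by rw [smul_smul, mul_inv_cancel₀ hq0.ne', one_smul]⟩
  have hu : u ⬝ᵥ u = 1 := by
    rw [smul_dotProduct, dotProduct_smul, smul_eq_mul, smul_eq_mul, ← mul_assoc] at hqq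
    exact mul_left_cancel₀ (mul_pos hq0 hq0).ne' (by linarith)
  have h := exp_sub_vecMulVec_ge_of_unit hH hu (r := r * (q * q)) (by positivity)
  have e : (-r) • Matrix.vecMulVec (q • u) (q • u) =
      (-(r * (q * q))) • Matrix.vecMulVec u u := by
    ext i j
    simp [Matrix.vecMulVec_apply]
    ring
  rw [← hqq, e]
  simp only [Matrix.mulVec_smul, dotProduct_smul, smul_dotProduct, smul_eq_mul]
  nlinarith [mul_le_mul_of_nonneg_left h (mul_pos hq0 hq0).le]

/-- The expected trace exponential after a random rank one step of size `r` with
probability `p`. -/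
theorem trace_exp_bernoulli_step {H : Matrix n n ℝ} (hH : H.IsHermitian) (v : n → ℝ)
    {p r s : ℝ} (hp : 0 ≤ p) (hp1 : p ≤ 1) (hr : 0 ≤ r) (hs : 0 ≤ s)
    (h : p = 1 ∨ 1 - s ≤ Real.exp (-(r * (v ⬝ᵥ v)))) :
    p * (NormedSpace.exp (H + (-r) • Matrix.vecMulVec v v)).trace +
        (1 - p) * (NormedSpace.exp H).trace ≤
      (NormedSpace.exp (H + (-(p * r * (1 - s))) • Matrix.vecMulVec v v)).trace := by
  rcases h with rfl | h
  -- For `p = 1` nothing is random, and monotonicity of `tr exp` suffices. This is why no bound on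
  -- `r |v|²` is needed for columns selected with certainty.
  · rw [sub_self, zero_mul, add_zero, one_mul, one_mul]
    have h1 := isHermitian_add_smul_vecMulVec hH (-r) v
    have h2 := trace_exp_add_ge h1 (r * s) v
    have e : H + (-r) • Matrix.vecMulVec v v + (r * s) • Matrix.vecMulVec v v =
        H + (-(r * (1 - s))) • Matrix.vecMulVec v v := by module
    rw [e] at h2
    nlinarith [mul_nonneg (mul_nonneg hr hs) (dotProduct_exp_nonneg h1 v)]
  · have h1 := isHermitian_add_smul_vecMulVec hH (-r) v
    -- Klein's inequality is used twice: at `H - r v vᵀ`, to bound the gain of the random step, and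
    -- at `H` (in `h3`), to bound the cost of the deterministic one. The loss `1 - s` absorbs the
    -- discrepancy between the two quadratic forms.
    have h2 := trace_exp_add_ge h1 r v
    have e : H + (-r) • Matrix.vecMulVec v v + r • Matrix.vecMulVec v v = H := by module
    rw [e] at h2
    have h3 := trace_exp_add_ge hH (-(p * r * (1 - s))) v
    have h4 := exp_sub_vecMulVec_ge hH v hr
    have h5 := mul_le_mul_of_nonneg_right h (dotProduct_exp_nonneg hH v)
    have h6 := mul_le_mul_of_nonneg_left (h5.trans h4) (mul_nonneg hp hr)
    nlinarith [mul_le_mul_of_nonneg_left h2 hp]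

/-- A quadratic form that exceeds `t |x|²` somewhere makes `tr (exp H - H - 1)` large. -/
theorem trace_exp_sub_ge {H : Matrix n n ℝ} (hH : H.IsHermitian) {t : ℝ} (ht : 0 ≤ t)
    {x : n → ℝ} (hx : t * (x ⬝ᵥ x) < x ⬝ᵥ H *ᵥ x) :
    Real.exp t - t - 1 ≤ (NormedSpace.exp H).trace - H.trace - Fintype.card n := by
  obtain ⟨u, l, h⟩ := exists_isEigenfamily hH
  have h1 := h.pow_quad x 1
  rw [pow_one] at h1
  obtain ⟨k, hk⟩ : ∃ k, t < l k := by
    by_contra! hle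
    rw [h1, ← h.parseval, Finset.mul_sum] at hx
    refine hx.not_ge (Finset.sum_le_sum fun k _ => ?_)
    rw [pow_one]
    exact mul_le_mul_of_nonneg_right (hle k) (sq_nonneg _)
  have htr : H.trace = ∑ k, l k := by
    rw [h.trace_eq]
    refine Finset.sum_congr rfl fun k _ => ?_
    rw [h.mulVec_eq, dotProduct_smul, h.norm_one, smul_eq_mul, mul_one]
  have e : (NormedSpace.exp H).trace - H.trace - Fintype.card n =
      ∑ k, (Real.exp (l k) - l k - 1) := by
    rw [h.exp_trace, htr]
    simp [Finset.sum_sub_distrib]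
  rw [e]
  have h2 : Real.exp (l k) - l k - 1 ≤ ∑ k, (Real.exp (l k) - l k - 1) :=
    Finset.single_le_sum (f := fun k => Real.exp (l k) - l k - 1)
      (fun i _ => by have := Real.add_one_le_exp (l i); linarith) (Finset.mem_univ k)
  refine le_trans ?_ h2
  -- With `exp t ≥ 1`, this shows that `exp l - l - 1` is at least its value at `t` for `l ≥ t`.
  have h3 : Real.exp t * (1 + (l k - t)) ≤ Real.exp (l k) := by
    have := Real.add_one_le_exp (l k - t)
    calc Real.exp t * (1 + (l k - t)) ≤ Real.exp t * Real.exp (l k - t) := by gcongr; linarith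
      _ = Real.exp (l k) := by rw [← Real.exp_add]; ring_nf
  have h4 := Real.one_le_exp ht
  nlinarith

end Spectral

/-! ## Sums over independent Bernoulli choices -/

/-- The weight of `ω` under the product of Bernoulli laws with parameters `p i`. -/
def bernoulliWeight {N : ℕ} (p : Fin N → ℝ) (ω : Fin N → Bool) : ℝ :=
  ∏ i, if ω i then p i else 1 - p i

theorem bernoulliWeight_nonneg {N : ℕ} {p : Fin N → ℝ} (hp : ∀ i, 0 ≤ p i)
    (hp1 : ∀ i, p i ≤ 1) (ω : Fin N → Bool) : 0 ≤ bernoulliWeight p ω := by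
  refine Finset.prod_nonneg fun i _ => ?_
  split_ifs
  · exact hp i
  · exact sub_nonneg.2 (hp1 i)

theorem sum_bernoulliWeight_succ {N : ℕ} (p : Fin (N + 1) → ℝ) (f : (Fin (N + 1) → Bool) → ℝ) :
    ∑ ω, bernoulliWeight p ω * f ω =
      ∑ ω : Fin N → Bool, bernoulliWeight (fun i => p i.succ) ω *
        (p 0 * f (Fin.cons true ω) + (1 - p 0) * f (Fin.cons false ω)) := by
  rw [← (Fin.consEquiv fun _ => Bool).sum_comp, Fintype.sum_prod_type_right]
  refine Finset.sum_congr rfl fun ω _ => ?_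
  have e : ∀ b, Fin.consEquiv (fun _ => Bool) (b, ω) = Fin.cons b ω := fun _ => rfl
  simp only [Fintype.sum_bool, e, bernoulliWeight, Fin.prod_univ_succ,
    Fin.cons_zero, Fin.cons_succ, if_true, Bool.false_eq_true, if_false]
  ring

/-- If adding a random `Y i` to an element of `𝒢` does not increase the expectation of `F` more
than adding `Z i`, then adding independent copies of all `Y i` does not increase it more than
adding `∑ Z i`. -/
theorem sum_bernoulliWeight_le {V : Type*} [AddCommMonoid V] (𝒢 : AddSubmonoid V) (F : V → ℝ)
    {N : ℕ} (p : Fin N → ℝ) (hp : ∀ i, 0 ≤ p i) (hp1 : ∀ i, p i ≤ 1)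
    (Y : Fin N → Bool → V) (Z : Fin N → V) (hY : ∀ i b, Y i b ∈ 𝒢) (hZ : ∀ i, Z i ∈ 𝒢)
    (step : ∀ i, ∀ H ∈ 𝒢, p i * F (H + Y i true) + (1 - p i) * F (H + Y i false) ≤ F (H + Z i))
    (H : V) (hH : H ∈ 𝒢) :
    ∑ ω, bernoulliWeight p ω * F (H + ∑ i, Y i (ω i)) ≤ F (H + ∑ i, Z i) := by
  induction N generalizing H with
  | zero => simp [bernoulliWeight]
  | succ N ih =>
    rw [sum_bernoulliWeight_succ]
    have h1 : ∀ b, ∑ ω : Fin N → Bool, bernoulliWeight (fun i => p i.succ) ω *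
        F (H + ∑ i, Y i ((Fin.cons b ω : Fin (N + 1) → Bool) i)) ≤
        F (H + ∑ i : Fin N, Z i.succ + Y 0 b) := by
      intro b
      have := ih (fun i => p i.succ) (fun i => hp _) (fun i => hp1 _) (fun i => Y i.succ)
        (fun i => Z i.succ) (fun i => hY _) (fun i => hZ _) (fun i => step _) (H + Y 0 b)
        (𝒢.add_mem hH (hY _ _))
      simp only [Fin.sum_univ_succ (n := N), Fin.cons_zero, Fin.cons_succ, ← add_assoc]
      rwa [add_right_comm H]
    -- The induction hypothesis has already replaced the other variables by `Z`, so the first one is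
    -- averaged on top of a deterministic element of `𝒢`.
    have h2 := step 0 (H + ∑ i : Fin N, Z i.succ)
      (𝒢.add_mem hH (𝒢.sum_mem fun i _ => hZ _))
    have h3 : H + ∑ i, Z i = H + ∑ i : Fin N, Z i.succ + Z 0 := by
      rw [Fin.sum_univ_succ, add_assoc, add_comm (Z 0)]
    rw [h3]
    refine le_trans (le_of_eq ?_) ((add_le_add (mul_le_mul_of_nonneg_left (h1 true) (hp 0))
      (mul_le_mul_of_nonneg_left (h1 false) (sub_nonneg.2 (hp1 0)))).trans h2)
    rw [Finset.mul_sum, Finset.mul_sum, ← Finset.sum_add_distrib]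
    refine Finset.sum_congr rfl fun ω _ => ?_
    ring

theorem sum_bernoulliWeight {N : ℕ} (p : Fin N → ℝ) : ∑ ω, bernoulliWeight p ω = 1 := by
  induction N with
  | zero => simp [bernoulliWeight]
  | succ N ih =>
    have := sum_bernoulliWeight_succ p fun _ => 1
    simpa [ih] using this

/-- Markov's inequality. -/
theorem mul_sum_filter_le {Ω : Type*} [Fintype Ω] (w f : Ω → ℝ) (hw : ∀ ω, 0 ≤ w ω)
    (hf : ∀ ω, 0 ≤ f ω) (a : ℝ) (P : Ω → Prop) [DecidablePred P] (h : ∀ ω, P ω → a ≤ f ω) :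
    a * ∑ ω with P ω, w ω ≤ ∑ ω, w ω * f ω := by
  rw [Finset.mul_sum]
  calc ∑ ω with P ω, a * w ω ≤ ∑ ω with P ω, w ω * f ω :=
        Finset.sum_le_sum fun ω hω => by
          rw [mul_comm a]
          exact mul_le_mul_of_nonneg_left (h ω (Finset.mem_filter.1 hω).2) (hw ω)
    _ ≤ _ := Finset.sum_le_sum_of_subset_of_nonneg (Finset.filter_subset _ _)
        fun ω _ _ => mul_nonneg (hw ω) (hf ω)

/-- A Chernoff bound for the number of successes. -/
theorem sum_bernoulliWeight_card_gt {N : ℕ} (p : Fin N → ℝ) (hp : ∀ i, 0 ≤ p i)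
    (hp1 : ∀ i, p i ≤ 1) (t : ℝ) :
    ∑ ω with t < ∑ i, (if ω i then 1 else 0 : ℝ), bernoulliWeight p ω ≤
      Real.exp (2 * ∑ i, p i - t) := by
  have h := sum_bernoulliWeight_le (⊤ : AddSubmonoid ℝ) Real.exp p hp hp1
    (fun _ b => if b then 1 else 0) (fun i => 2 * p i) (fun _ _ => trivial) (fun _ => trivial)
    (fun i H _ => by
      simp only [if_true, Bool.false_eq_true, if_false, add_zero, Real.exp_add]
      have h1 := Real.add_one_le_exp (2 * p i)
      have h2 : Real.exp 1 ≤ 3 := by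
        have := Real.exp_one_lt_d9
        linarith
      have h3 := Real.exp_pos H
      have h4 : p i * Real.exp 1 + (1 - p i) ≤ Real.exp (2 * p i) := by nlinarith [hp i]
      nlinarith) 0 trivial
  simp only [zero_add] at h
  have h2 := mul_sum_filter_le (bernoulliWeight p)
    (fun ω => Real.exp (∑ i, (if ω i then 1 else 0 : ℝ))) (bernoulliWeight_nonneg hp hp1)
    (fun ω => (Real.exp_pos _).le) (Real.exp t)
    (fun ω => t < ∑ i, (if ω i then 1 else 0 : ℝ)) (fun ω hω => Real.exp_le_exp.2 hω.le)
  rw [Real.exp_sub, le_div_iff₀ (Real.exp_pos t), mul_comm, Finset.mul_sum Finset.univ]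
  exact h2.trans h

open Classical in
/-- A lower tail bound for a sum of independent positive semidefinite matrices of rank one. -/
theorem sum_bernoulliWeight_quadratic_lt {n : Type*} [Fintype n] {N : ℕ} (p r : Fin N → ℝ)
    (v : Fin N → n → ℝ) {s t : ℝ} (hp : ∀ i, 0 ≤ p i) (hp1 : ∀ i, p i ≤ 1) (hr : ∀ i, 0 ≤ r i)
    (hs : 0 ≤ s) (ht : 0 ≤ t)
    (h : ∀ i, p i = 1 ∨ 1 - s ≤ Real.exp (-(r i * (v i ⬝ᵥ v i)))) :
    (Real.exp t - t - 1) * ∑ ω with ∃ x : n → ℝ, t * (x ⬝ᵥ x) <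
        ∑ i, (p i * r i * (1 - s) - if ω i then r i else 0) * (v i ⬝ᵥ x) ^ 2,
      bernoulliWeight p ω ≤ s * ∑ i, p i * r i * (v i ⬝ᵥ v i) := by
  let W : Fin N → Matrix n n ℝ := fun i => Matrix.vecMulVec (v i) (v i)
  let Y : Fin N → Bool → Matrix n n ℝ := fun i b => (-(if b then r i else 0)) • W i
  let Z : Fin N → Matrix n n ℝ := fun i => (-(p i * r i * (1 - s))) • W i
  -- This starting point cancels all deterministic steps, so the expected trace exponential is at
  -- most `tr exp 0`, the dimension.
  let H₀ : Matrix n n ℝ := ∑ i, (p i * r i * (1 - s)) • W i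
  let 𝒢 : AddSubmonoid (Matrix n n ℝ) := (selfAdjoint (Matrix n n ℝ)).toAddSubmonoid
  have hW : ∀ (a : ℝ) i, a • W i ∈ 𝒢 := by
    intro a i
    change star (a • W i) = a • W i
    rw [Matrix.star_eq_conjTranspose]
    ext j k
    simp [W, Matrix.vecMulVec_apply, mul_comm]
  have hH₀ : H₀ ∈ 𝒢 := 𝒢.sum_mem fun i _ => hW _ i
  have hWtr : ∀ i, (W i).trace = v i ⬝ᵥ v i := fun i => Matrix.trace_vecMulVec _ _
  have hHZ : H₀ + ∑ i, Z i = 0 := by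
    simp only [H₀, Z, neg_smul, Finset.sum_neg_distrib, add_neg_cancel]
  have h1 := sum_bernoulliWeight_le 𝒢 (fun H => (NormedSpace.exp H).trace) p hp hp1 Y Z
    (fun i b => hW _ i) (fun i => hW _ i) (fun i H hH => by
      have := trace_exp_bernoulli_step (H := H) hH (v i) (hp i) (hp1 i) (hr i) hs (h i)
      simpa [Y, Z, W] using this) H₀ hH₀
  -- The same averaging lemma, with equality in every step, computes the expected trace. The
  -- dimension then cancels in `tr (exp H - H - 1)`, leaving only `s ∑ pᵢ rᵢ |vᵢ|²`.
  have h2 := sum_bernoulliWeight_le 𝒢 (fun H => -H.trace) p hp hp1 Y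
    (fun i => (-(p i * r i)) • W i) (fun i b => hW _ i) (fun i => hW _ i) (fun i H hH => by
      refine le_of_eq ?_
      simp only [Y, if_true, Bool.false_eq_true, if_false, Matrix.trace_add, Matrix.trace_smul,
        smul_eq_mul]
      ring) H₀ hH₀
  rw [hHZ] at h1
  simp only [NormedSpace.exp_zero, Matrix.trace_one] at h1
  have h3 : -(H₀ + ∑ i, (-(p i * r i)) • W i).trace = s * ∑ i, p i * r i * (v i ⬝ᵥ v i) := by
    simp only [H₀, Matrix.trace_add, Matrix.trace_sum, Matrix.trace_smul, hWtr, smul_eq_mul,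
      ← Finset.sum_add_distrib, ← Finset.sum_neg_distrib, Finset.mul_sum]
    exact Finset.sum_congr rfl fun i _ => by ring
  rw [h3] at h2
  have hherm : ∀ ω : Fin N → Bool, (H₀ + ∑ i, Y i (ω i)).IsHermitian := fun ω =>
    𝒢.add_mem hH₀ (𝒢.sum_mem fun i _ => hW _ i)
  have hnonneg : ∀ ω : Fin N → Bool, 0 ≤ (NormedSpace.exp (H₀ + ∑ i, Y i (ω i))).trace -
      (H₀ + ∑ i, Y i (ω i)).trace - Fintype.card n := by
    intro ω
    obtain ⟨u, l, hu⟩ := exists_isEigenfamily (hherm ω)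
    have e : (H₀ + ∑ i, Y i (ω i)).trace = ∑ k, l k := by
      rw [hu.trace_eq]
      refine Finset.sum_congr rfl fun k _ => ?_
      rw [hu.mulVec_eq, dotProduct_smul, hu.norm_one, smul_eq_mul, mul_one]
    rw [hu.exp_trace, e]
    have : (Fintype.card n : ℝ) = ∑ _k : n, (1 : ℝ) := by simp
    rw [this, ← Finset.sum_sub_distrib, ← Finset.sum_sub_distrib]
    exact Finset.sum_nonneg fun k _ => by have := Real.add_one_le_exp (l k); linarith
  have h4 := mul_sum_filter_le (bernoulliWeight p) _ (bernoulliWeight_nonneg hp hp1) hnonneg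
    (Real.exp t - t - 1) (fun ω => ∃ x : n → ℝ, t * (x ⬝ᵥ x) <
        ∑ i, (p i * r i * (1 - s) - if ω i then r i else 0) * (v i ⬝ᵥ x) ^ 2) (by
      rintro ω ⟨x, hx⟩
      refine trace_exp_sub_ge (hherm ω) ht (x := x) (hx.trans_le (le_of_eq ?_))
      simp only [H₀, Y, ← Finset.sum_add_distrib, ← add_smul, Matrix.sum_mulVec,
        dotProduct_sum, Matrix.smul_mulVec, dotProduct_smul, W, dotProduct_vecMulVec_mulVec,
        smul_eq_mul]
      refine Finset.sum_congr rfl fun i _ => ?_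
      rw [dotProduct_comm x]
      ring)
  refine h4.trans ?_
  have h5 := sum_bernoulliWeight p
  simp only [mul_sub, Finset.sum_sub_distrib, ← Finset.sum_mul, h5, one_mul]
  simp only [mul_neg, Finset.sum_neg_distrib] at h2
  linarith

/-- The probability of a set of selections under `rlsSampling`. -/
theorem rlsSampling_toOuterMeasure {m : ℕ} (K : Matrix (Fin m) (Fin m) ℝ) (η c δ : ℝ)
    (P : (Fin m → Bool) → Prop) [DecidablePred P] :
    (rlsSampling K η c δ).toOuterMeasure {ω | P ω} =
      ENNReal.ofReal (1 - ∑ ω with ¬ P ω, bernoulliWeight (rlsProb K η c δ) ω) := by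
  have hw := bernoulliWeight_nonneg (rlsProb_nonneg K η c δ) (rlsProb_le_one K η c δ)
  have h1 : 1 - ∑ ω with ¬ P ω, bernoulliWeight (rlsProb K η c δ) ω =
      ∑ ω with P ω, bernoulliWeight (rlsProb K η c δ) ω := by
    rw [← sum_bernoulliWeight (rlsProb K η c δ),
      ← Finset.sum_filter_add_sum_filter_not Finset.univ P]
    ring
  rw [h1, ENNReal.ofReal_sum_of_nonneg fun ω _ => hw ω, PMF.toOuterMeasure_apply_fintype,
    Finset.sum_filter]
  refine Finset.sum_congr rfl fun ω _ => ?_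
  rw [Set.indicator_apply]
  refine if_congr Iff.rfl ?_ rfl
  rw [rlsSampling, PMF.ofFintype_apply, bernoulliWeight, ENNReal.ofReal_prod_of_nonneg]
  · exact Finset.prod_congr rfl fun i _ => by split_ifs <;> rfl
  · intro i _
    split_ifs
    · exact rlsProb_nonneg K η c δ i
    · exact sub_nonneg.2 (rlsProb_le_one K η c δ i)

/-! ## Ridge leverage scores and the guarantee of the sampling step -/

section Leverage

variable {m : ℕ} {A : Matrix (Fin m) (Fin m) ℝ}

theorem posDef_add_smul_one (hA : A.PosSemidef) {μ : ℝ} (hμ : 0 < μ) :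
    (A + μ • (1 : Matrix (Fin m) (Fin m) ℝ)).PosDef :=
  Matrix.PosDef.posSemidef_add hA (Matrix.PosDef.one.smul hμ)

theorem add_smul_one_mul_inv (hA : A.PosSemidef) {μ : ℝ} (hμ : 0 < μ) :
    (A + μ • (1 : Matrix (Fin m) (Fin m) ℝ)) * (A + μ • 1)⁻¹ = 1 :=
  Matrix.mul_nonsing_inv _ ((Matrix.isUnit_iff_isUnit_det _).1 (posDef_add_smul_one hA hμ).isUnit)

theorem inv_mul_add_smul_one (hA : A.PosSemidef) {μ : ℝ} (hμ : 0 < μ) :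
    (A + μ • (1 : Matrix (Fin m) (Fin m) ℝ))⁻¹ * (A + μ • 1) = 1 :=
  Matrix.nonsing_inv_mul _ ((Matrix.isUnit_iff_isUnit_det _).1 (posDef_add_smul_one hA hμ).isUnit)

theorem transpose_eq_of_posSemidef {n : Type*} {A : Matrix n n ℝ} (hA : A.PosSemidef) :
    Aᵀ = A := by
  rw [← Matrix.conjTranspose_eq_transpose_of_trivial]
  exact hA.isHermitian

theorem dotProduct_mulVec_comm_of_transpose_eq {n : Type*} [Fintype n] {A : Matrix n n ℝ}
    (hA : Aᵀ = A) (x y : n → ℝ) : x ⬝ᵥ A *ᵥ y = A *ᵥ x ⬝ᵥ y := by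
  rw [Matrix.dotProduct_mulVec, ← Matrix.mulVec_transpose, hA]

theorem posSemidef_dotProduct_nonneg {n : Type*} [Fintype n] {A : Matrix n n ℝ}
    (hA : A.PosSemidef) (x : n → ℝ) : 0 ≤ x ⬝ᵥ A *ᵥ x := by
  simpa using hA.dotProduct_mulVec_nonneg x

/-- With `N = A + μ`, the product is the congruence `N⁻¹ (N A) N⁻¹`, and `N A = A² + μ A`. -/
theorem posSemidef_mul_inv (hA : A.PosSemidef) {μ : ℝ} (hμ : 0 < μ) :
    (A * (A + μ • (1 : Matrix (Fin m) (Fin m) ℝ))⁻¹).PosSemidef := by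
  set N := A + μ • (1 : Matrix (Fin m) (Fin m) ℝ) with hN
  have h1 : N⁻¹ * N = 1 := inv_mul_add_smul_one hA hμ
  have hNT : (N⁻¹)ᵀ = N⁻¹ :=
    transpose_eq_of_posSemidef (posDef_add_smul_one hA hμ).posSemidef.inv
  have h2 : (N * A).PosSemidef := by
    rw [hN, add_mul, Matrix.smul_mul, Matrix.one_mul]
    refine Matrix.PosSemidef.add ?_ (hA.smul hμ.le)
    have := Matrix.posSemidef_conjTranspose_mul_self A
    rwa [hA.isHermitian] at this
  have h3 := h2.conjTranspose_mul_mul_same N⁻¹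
  rw [Matrix.conjTranspose_eq_transpose_of_trivial, hNT, ← Matrix.mul_assoc, h1,
    Matrix.one_mul] at h3
  exact h3

open scoped MatrixOrder in
theorem exists_eq_transpose_mul_self (hA : A.PosSemidef) :
    ∃ Ψ : Matrix (Fin m) (Fin m) ℝ, A = Ψᵀ * Ψ := by
  obtain ⟨Ψ, hΨ⟩ := CStarAlgebra.nonneg_iff_eq_star_mul_self.mp hA.nonneg
  refine ⟨Ψ, ?_⟩
  rwa [Matrix.star_eq_conjTranspose, Matrix.conjTranspose_eq_transpose_of_trivial] at hΨ

/-- Vectors whose Gram matrix is `A (A + μ)⁻¹`. -/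
theorem exists_gram_mul_inv (hA : A.PosSemidef) {μ : ℝ} (hμ : 0 < μ) :
    ∃ v : Fin m → Fin m → ℝ,
      (∀ i j, v i ⬝ᵥ v j = (A * (A + μ • (1 : Matrix (Fin m) (Fin m) ℝ))⁻¹) i j) ∧
      ∀ z : Fin m → ℝ, ∃ x, (∀ i, v i ⬝ᵥ x = (A *ᵥ z) i) ∧
        x ⬝ᵥ x = A *ᵥ z ⬝ᵥ A *ᵥ z + μ * (z ⬝ᵥ A *ᵥ z) := by
  obtain ⟨Ψ, hΨ⟩ := exists_eq_transpose_mul_self (posSemidef_mul_inv hA hμ)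
  have hN := inv_mul_add_smul_one hA hμ
  set N := A + μ • (1 : Matrix (Fin m) (Fin m) ℝ) with hNdef
  have h1 : ∀ z : Fin m → ℝ, Ψᵀ *ᵥ (Ψ *ᵥ (N *ᵥ z)) = A *ᵥ z := by
    intro z
    rw [Matrix.mulVec_mulVec, Matrix.mulVec_mulVec, ← hΨ, Matrix.mul_assoc, hN, Matrix.mul_one]
  refine ⟨Ψᵀ, fun i j => ?_, fun z => ⟨Ψ *ᵥ (N *ᵥ z), fun i => ?_, ?_⟩⟩
  · rw [hΨ, Matrix.mul_apply]
    rfl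
  · rw [← h1]
    rfl
  · rw [Matrix.dotProduct_mulVec, ← Matrix.mulVec_transpose, h1, hNdef, Matrix.add_mulVec,
      dotProduct_add, Matrix.smul_mulVec, Matrix.one_mulVec, dotProduct_smul, smul_eq_mul,
      dotProduct_comm _ z]

theorem ridgeLeverage_nonneg (hA : A.PosSemidef) {η : ℝ} (hη : 0 < η * m) (i : Fin m) :
    0 ≤ ridgeLeverage A η i := by
  obtain ⟨v, hv, -⟩ := exists_gram_mul_inv hA hη
  rw [ridgeLeverage, ← hv]
  simpa using dotProduct_star_self_nonneg (v i)

theorem one_le_log₁ (t : ℝ) : 1 ≤ log₁ t := le_max_left _ _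

theorem le_exp_log₁ {t : ℝ} (ht : 0 < t) : t ≤ Real.exp (log₁ t) := by
  conv_lhs => rw [← Real.exp_log ht]
  exact Real.exp_le_exp.2 (le_max_right _ _)

theorem rlsProb_cases (hA : A.PosSemidef) {η : ℝ} (hη : 0 < η * m) {c : ℝ} (hc : 0 < c) (δ : ℝ)
    (i : Fin m) : rlsProb A η c δ i = 1 ∨
      rlsProb A η c δ i = c * ridgeLeverage A η i * log₁ (effectiveDim A η / δ) := by
  have h0 : 0 ≤ c * ridgeLeverage A η i * log₁ (effectiveDim A η / δ) :=
    mul_nonneg (mul_nonneg hc.le (ridgeLeverage_nonneg hA hη i))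
      (zero_le_one.trans (one_le_log₁ _))
  rw [rlsProb]
  rcases le_total 1 (c * ridgeLeverage A η i * log₁ (effectiveDim A η / δ)) with h | h
  · left
    rw [min_eq_left h, max_eq_right zero_le_one]
  · right
    rw [min_eq_right h, max_eq_right h0]

theorem rlsProb_le (hA : A.PosSemidef) {η : ℝ} (hη : 0 < η * m) {c : ℝ} (hc : 0 < c) (δ : ℝ)
    (i : Fin m) :
    rlsProb A η c δ i ≤ c * ridgeLeverage A η i * log₁ (effectiveDim A η / δ) :=
  max_le (mul_nonneg (mul_nonneg hc.le (ridgeLeverage_nonneg hA hη i))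
      (zero_le_one.trans (one_le_log₁ _))) (min_le_right _ _)

theorem sum_ridgeLeverage (A : Matrix (Fin m) (Fin m) ℝ) (η : ℝ) :
    ∑ i, ridgeLeverage A η i = effectiveDim A η := rfl

/-- What a good selection of columns achieves: a vector whose image under `A` vanishes on the
selected indices has small energy. -/
def IsGoodSelection (A : Matrix (Fin m) (Fin m) ℝ) (μ : ℝ) (ω : Fin m → Bool) : Prop :=
  ∀ z : Fin m → ℝ, (∀ i, ω i = true → (A *ᵥ z) i = 0) →
    A *ᵥ z ⬝ᵥ A *ᵥ z ≤ μ / 2 * (z ⬝ᵥ A *ᵥ z)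

theorem exp_four_mul_ge {L : ℝ} (hL : 1 ≤ L) :
    3 / 2 * L * Real.exp L ≤ Real.exp (4 * L) - 4 * L - 1 := by
  have h1 := Real.add_one_le_exp (3 * L)
  have h2 := Real.add_one_le_exp L
  have h3 : Real.exp (4 * L) = Real.exp L * Real.exp (3 * L) := by
    rw [← Real.exp_add]; ring_nf
  have h4 := mul_le_mul_of_nonneg_left h1 (Real.exp_pos L).le
  nlinarith

open Classical in
/-- Sampling by ridge leverage scores fails with probability at most `δ / 2`. -/
theorem sum_bernoulliWeight_not_isGoodSelection (hA : A.PosSemidef) {η : ℝ} (hη : 0 < η * m)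
    {c δ : ℝ} (hc : 1024 ≤ c) (hδ : 0 < δ) (hd : 0 < effectiveDim A η) :
    ∑ ω with ¬ IsGoodSelection A (η * m) ω, bernoulliWeight (rlsProb A η c δ) ω ≤ δ / 2 := by
  obtain ⟨v, hv, hx⟩ := exists_gram_mul_inv hA hη
  set p := rlsProb A η c δ with hp
  set L := log₁ (effectiveDim A η / δ) with hL
  have hL1 : 1 ≤ L := one_le_log₁ _
  have hL0 : 0 < L := by linarith
  have hc0 : 0 < c := by linarith
  have hp0 : ∀ i, 0 ≤ p i := rlsProb_nonneg A η c δ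
  have hp1 : ∀ i, p i ≤ 1 := rlsProb_le_one A η c δ
  have hl : ∀ i, v i ⬝ᵥ v i = ridgeLeverage A η i := fun i => hv i i
  have hl0 := ridgeLeverage_nonneg hA hη
  have hcases := rlsProb_cases hA hη hc0 δ
  have hpv : ∀ i, p i = 0 → v i = 0 := by
    intro i hi
    rcases hcases i with h | h
    · rw [← hp, hi] at h
      exact absurd h zero_ne_one
    · rw [← hp, hi, ← hl] at h
      have h0 : v i ⬝ᵥ v i = 0 := by
        rcases mul_eq_zero.1 h.symm with h | h
        · exact (mul_eq_zero.1 h).resolve_left hc0.ne'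
        · exact absurd h hL0.ne'
      exact dotProduct_self_eq_zero.1 h0
  -- This is importance weighting: `pᵢ rᵢ = 16 L`. Where `pᵢ = 0` the quotient is `0` by convention,
  -- which is harmless since `vᵢ = 0` there.
  set r : Fin m → ℝ := fun i => 16 * L / p i with hr
  have hpr : ∀ i, p i ≠ 0 → p i * r i = 16 * L := fun i hi => mul_div_cancel₀ _ hi
  have hs1 : 16 / c ≤ 1 / 64 := by
    rw [div_le_div_iff₀ hc0 (by norm_num)]
    linarith
  have key := sum_bernoulliWeight_quadratic_lt p r v (s := 16 / c) (t := 4 * L) hp0 hp1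
    (fun i => div_nonneg (by positivity) (hp0 i)) (by positivity) (by positivity) (by
      intro i
      rcases hcases i with h | h
      · exact Or.inl h
      right
      refine le_trans ?_ (Real.add_one_le_exp _)
      rcases eq_or_ne (p i) 0 with h0 | h0
      · rw [hpv i h0]
        have : 0 < 16 / c := by positivity
        simp only [dotProduct_zero, mul_zero, neg_zero, zero_add]
        linarith
      -- The leverage score cancels against the sampling probability, so all unsaturated columns
      -- contribute steps of the same size `s = 16 / c`.
      · have : r i * (v i ⬝ᵥ v i) = 16 / c := by
          rw [hl, hr]
          change 16 * L / p i * _ = _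
          rw [div_mul_eq_mul_div, div_eq_div_iff h0 hc0.ne', hp, h]
          ring
        rw [this]
        linarith)
  have hsum : ∑ i, p i * r i * (v i ⬝ᵥ v i) = 16 * L * effectiveDim A η := by
    rw [← sum_ridgeLeverage, Finset.mul_sum]
    refine Finset.sum_congr rfl fun i _ => ?_
    rcases eq_or_ne (p i) 0 with h0 | h0
    · rw [← hl, hpv i h0]
      simp
    · rw [hpr i h0, hl]
  rw [hsum] at key
  have hmono : ∑ ω with ¬ IsGoodSelection A (η * m) ω, bernoulliWeight p ω ≤
      ∑ ω with ∃ x : Fin m → ℝ, 4 * L * (x ⬝ᵥ x) <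
        ∑ i, (p i * r i * (1 - 16 / c) - if ω i then r i else 0) * (v i ⬝ᵥ x) ^ 2,
      bernoulliWeight p ω := by
    refine Finset.sum_le_sum_of_subset_of_nonneg (fun ω hω => ?_)
      fun ω _ _ => bernoulliWeight_nonneg hp0 hp1 ω
    rw [Finset.mem_filter] at hω ⊢
    refine ⟨hω.1, ?_⟩
    have hω2 := hω.2
    simp only [IsGoodSelection, not_forall, not_le] at hω2
    obtain ⟨z, hz, hlt⟩ := hω2
    obtain ⟨x, hx1, hx2⟩ := hx z
    refine ⟨x, ?_⟩
    have e : ∑ i, (p i * r i * (1 - 16 / c) - if ω i then r i else 0) * (v i ⬝ᵥ x) ^ 2 =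
        16 * L * (1 - 16 / c) * (A *ᵥ z ⬝ᵥ A *ᵥ z) := by
      rw [dotProduct, Finset.mul_sum]
      refine Finset.sum_congr rfl fun i _ => ?_
      rw [hx1]
      by_cases hi : ω i = true
      · rw [hz i hi]
        simp
      · rw [if_neg hi, sub_zero]
        rcases eq_or_ne (p i) 0 with h0 | h0
        · rw [← hx1, hpv i h0]
          simp
        · rw [hpr i h0]
          ring
    rw [e, hx2]
    set a := A *ᵥ z ⬝ᵥ A *ᵥ z
    set b := η * m * (z ⬝ᵥ A *ᵥ z) with hb
    have hb0 : 0 ≤ b := mul_nonneg hη.le (posSemidef_dotProduct_nonneg hA z)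
    have hab : b < 2 * a := by linarith
    -- A failure means `b < 2 a`, so the left side is below `12 a`, while `1 - 16 / c ≥ 63 / 64`.
    have : 4 * (a + b) < 16 * (1 - 16 / c) * a := by nlinarith
    nlinarith
  have hE := exp_four_mul_ge hL1
  have hdE : effectiveDim A η ≤ δ * Real.exp L := by
    have := le_exp_log₁ (div_pos hd hδ)
    rwa [div_le_iff₀' hδ] at this
  set S := ∑ ω with ∃ x : Fin m → ℝ, 4 * L * (x ⬝ᵥ x) <
        ∑ i, (p i * r i * (1 - 16 / c) - if ω i then r i else 0) * (v i ⬝ᵥ x) ^ 2,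
      bernoulliWeight p ω with hS
  refine hmono.trans ?_
  have hS0 : 0 ≤ S := Finset.sum_nonneg fun ω _ => bernoulliWeight_nonneg hp0 hp1 ω
  have hLe : 0 < L * Real.exp L := mul_pos hL0 (Real.exp_pos _)
  have h1 := mul_le_mul_of_nonneg_right hE hS0
  -- The right side is `L δ exp L / 4`. Against the `3/2 · L exp L` of `hE` this even leaves `δ /
  -- 6`.
  have h2 : 16 / c * (16 * L * effectiveDim A η) ≤ 1 / 64 * (16 * L * (δ * Real.exp L)) := by
    gcongr
  have h3 : (L * Real.exp L) * S ≤ (L * Real.exp L) * (δ / 2) := by nlinarith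
  exact le_of_mul_le_mul_left h3 hLe

/-- The probability that many columns are selected is at most `δ / 2`. -/
theorem sum_bernoulliWeight_card_selection_gt (hA : A.PosSemidef) {η : ℝ} (hη : 0 < η * m)
    {c δ : ℝ} (hc : 0 < c) (hδ : 0 < δ) (hd : 1 / 3 ≤ effectiveDim A η) :
    ∑ ω with (2 * c + 9) * (effectiveDim A η * log₁ (effectiveDim A η / δ)) <
        ∑ i, (if ω i then 1 else 0 : ℝ), bernoulliWeight (rlsProb A η c δ) ω ≤ δ / 2 := by
  refine (sum_bernoulliWeight_card_gt _ (rlsProb_nonneg A η c δ) (rlsProb_le_one A η c δ)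
    _).trans ?_
  have hsum : ∑ i, rlsProb A η c δ i ≤
      c * (effectiveDim A η * log₁ (effectiveDim A η / δ)) := by
    refine (Finset.sum_le_sum fun i _ => rlsProb_le hA hη hc δ i).trans (le_of_eq ?_)
    rw [← Finset.sum_mul, ← Finset.mul_sum, sum_ridgeLeverage]
    ring
  set d := effectiveDim A η
  have hd0 : 0 < d := by linarith
  set L := log₁ (d / δ) with hL
  have hL1 : 1 ≤ L := one_le_log₁ _
  have hdE : d ≤ δ * Real.exp L := by
    have := le_exp_log₁ (div_pos hd0 hδ)
    rwa [div_le_iff₀' hδ] at this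
  have h1 : Real.exp (2 * ∑ i, rlsProb A η c δ i - (2 * c + 9) * (d * L)) ≤
      Real.exp (-2) * Real.exp (-L) := by
    rw [← Real.exp_add]
    refine Real.exp_le_exp.2 ?_
    -- The mean uses up `2 c d L`. The remaining `9 d L` is at least `3 L ≥ L + 2`, because `d ≥
    -- 1/3` and `L ≥ 1`.
    nlinarith
  refine h1.trans ?_
  have h2 : Real.exp (-2) ≤ 1 / 6 := by
    rw [Real.exp_neg, one_div]
    refine inv_anti₀ (by norm_num) ?_
    have h3 : Real.exp 2 = Real.exp 1 * Real.exp 1 := by rw [← Real.exp_add]; norm_num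
    have := Real.exp_one_gt_d9
    rw [h3]
    nlinarith
  have h3 : Real.exp (-L) ≤ 3 * δ := by
    rw [Real.exp_neg, inv_le_iff_one_le_mul₀ (Real.exp_pos L)]
    linarith
  nlinarith [Real.exp_pos (-L)]

end Leverage

/-! ## Repeated points -/

section Collision

variable {X : Type*} {m : ℕ}

open Classical in
/-- The matrix with entries `1[xᵢ = xⱼ]`. -/
def collision (x : Fin m → X) : Matrix (Fin m) (Fin m) ℝ :=
  Matrix.of fun i j => if x i = x j then 1 else 0

open Classical in
theorem collision_mulVec (x : Fin m → X) (z : Fin m → ℝ) (i : Fin m) :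
    (collision x *ᵥ z) i = ∑ j with x j = x i, z j := by
  rw [Finset.sum_filter, Matrix.mulVec, dotProduct]
  refine Finset.sum_congr rfl fun j _ => ?_
  simp [collision, eq_comm]

/-- The quadratic form is the sum, over the distinct points, of the squared sum of `z` over the
copies of that point. The left side is one of these squares. -/
theorem collision_mulVec_sq_le (x : Fin m → X) (z : Fin m → ℝ) (i : Fin m) :
    ((collision x *ᵥ z) i) ^ 2 ≤ z ⬝ᵥ collision x *ᵥ z := by
  classical
  have h : z ⬝ᵥ collision x *ᵥ z =
      ∑ y ∈ Finset.univ.image x, (∑ j with x j = y, z j) ^ 2 := by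
    have hmaps : ∀ j ∈ (Finset.univ : Finset (Fin m)), x j ∈ Finset.univ.image x :=
      fun j _ => Finset.mem_image_of_mem x (Finset.mem_univ j)
    rw [dotProduct, ← Finset.sum_fiberwise_of_maps_to hmaps]
    refine Finset.sum_congr rfl fun y _ => ?_
    rw [sq, Finset.sum_mul]
    refine Finset.sum_congr rfl fun j hj => ?_
    rw [collision_mulVec, (Finset.mem_filter.1 hj).2]
  rw [h, collision_mulVec]
  exact Finset.single_le_sum (f := fun y => (∑ j with x j = y, z j) ^ 2)
    (fun y _ => sq_nonneg _) (Finset.mem_image_of_mem x (Finset.mem_univ i))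

theorem collision_posSemidef (x : Fin m → X) : (collision x).PosSemidef := by
  refine Matrix.PosSemidef.of_dotProduct_mulVec_nonneg ?_ fun z => ?_
  · ext i j
    by_cases h : x i = x j
    · simp [collision, h]
    · simp [collision, h, Ne.symm h]
  · rw [star_trivial]
    rcases isEmpty_or_nonempty (Fin m) with h | ⟨⟨i⟩⟩
    · simp [dotProduct]
    · exact (sq_nonneg _).trans (collision_mulVec_sq_le x z i)

/-- For `z = (A + η m)⁻¹ eᵢ` one has `ℓᵢ = 1 - η m zᵢ` and `zᵢ = z·Az + η m |z|²`. Either the sum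
`σ` of `z` over the copies of `xᵢ` is large, or the other copies must cancel `zᵢ`, which costs norm.
Both cases force `zᵢ ≤ 1 / (η (m + 1/2))`. -/
theorem ridgeLeverage_ge {A : Matrix (Fin m) (Fin m) ℝ} (hA : A.PosSemidef) (x : Fin m → X)
    {η : ℝ} (hη : 0 < η) (hAx : ∀ z, η * (z ⬝ᵥ collision x *ᵥ z) ≤ z ⬝ᵥ A *ᵥ z) (i : Fin m) :
    1 / (2 * m + 1) ≤ ridgeLeverage A η i := by
  classical
  have hm : 0 < (m : ℝ) := by exact_mod_cast i.pos
  have hμ : 0 < η * m := by positivity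
  have hinv := add_smul_one_mul_inv hA hμ
  set N := A + (η * m) • (1 : Matrix (Fin m) (Fin m) ℝ) with hN
  set z := N⁻¹ *ᵥ Pi.single i 1 with hz
  have hNz : N *ᵥ z = Pi.single i 1 := by
    rw [hz, Matrix.mulVec_mulVec, hinv, Matrix.one_mulVec]
  have hl : ridgeLeverage A η i = 1 - η * m * z i := by
    have h1 : A * N⁻¹ = 1 - (η * m) • N⁻¹ := by
      rw [← hinv, hN, add_mul, Matrix.smul_mul, Matrix.one_mul, add_sub_cancel_right]
    have h2 : z i = N⁻¹ i i := by rw [hz, Matrix.mulVec_single_one]; rfl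
    rw [ridgeLeverage, h1, h2]
    simp
  have hzi : z i = z ⬝ᵥ A *ᵥ z + η * m * (z ⬝ᵥ z) := by
    have h1 : z ⬝ᵥ N *ᵥ z = z i := by rw [hNz, dotProduct_single_one]
    rw [← h1, hN, Matrix.add_mulVec, dotProduct_add, Matrix.smul_mulVec, Matrix.one_mulVec,
      dotProduct_smul, smul_eq_mul]
  have h2 := hAx z
  have h3 := collision_mulVec_sq_le x z i
  set σ := (collision x *ᵥ z) i with hσ
  have hi : i ∈ Finset.univ.filter fun j => x j = x i := by simp
  have h4 : σ - z i = ∑ j ∈ (Finset.univ.filter fun j => x j = x i).erase i, z j := by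
    rw [hσ, collision_mulVec, ← Finset.add_sum_erase _ _ hi]
    ring
  have h5 : (σ - z i) ^ 2 ≤ m * (z ⬝ᵥ z - z i ^ 2) := by
    rw [h4]
    refine sq_sum_le_card_mul_sum_sq.trans ?_
    have h6 : z ⬝ᵥ z - z i ^ 2 = ∑ j ∈ Finset.univ.erase i, z j ^ 2 := by
      rw [dotProduct, ← Finset.add_sum_erase _ _ (Finset.mem_univ i)]
      simp only [← sq]
      ring
    rw [h6]
    refine mul_le_mul ?_ ?_ (Finset.sum_nonneg fun _ _ => sq_nonneg _) hm.le
    · exact_mod_cast (Finset.card_le_univ _).trans (by simp)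
    · exact Finset.sum_le_sum_of_subset_of_nonneg
        (Finset.erase_subset_erase _ (Finset.filter_subset _ _)) fun _ _ _ => sq_nonneg _
  have h7 : η * (m + 1 / 2) * z i ^ 2 ≤ z i := by
    have h8 : z i ^ 2 / 2 ≤ σ ^ 2 + (σ - z i) ^ 2 := by nlinarith [sq_nonneg (2 * σ - z i)]
    nlinarith
  have h9 : η * (m + 1 / 2) * z i ≤ 1 := by
    by_contra! hlt
    have hpos : 0 < z i := by
      by_contra! hle
      have : η * (m + 1 / 2) * z i ≤ 0 := mul_nonpos_of_nonneg_of_nonpos (by positivity) hle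
      linarith
    nlinarith
  rw [hl, div_le_iff₀ (by positivity)]
  nlinarith

theorem effectiveDim_ge {A : Matrix (Fin m) (Fin m) ℝ} (hA : A.PosSemidef) (x : Fin m → X)
    {η : ℝ} (hη : 0 < η) (hAx : ∀ z, η * (z ⬝ᵥ collision x *ᵥ z) ≤ z ⬝ᵥ A *ᵥ z) (hm : 0 < m) :
    1 / 3 ≤ effectiveDim A η := by
  have h : ∑ _i : Fin m, 1 / (2 * (m : ℝ) + 1) ≤ effectiveDim A η := by
    rw [← sum_ridgeLeverage]
    exact Finset.sum_le_sum fun i _ => ridgeLeverage_ge hA x hη hAx i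
  refine le_trans ?_ h
  have : (1 : ℝ) ≤ m := by exact_mod_cast hm
  rw [Finset.sum_const, Finset.card_univ, Fintype.card_fin, nsmul_eq_mul, mul_one_div,
    div_le_div_iff₀ (by norm_num) (by positivity)]
  linarith

end Collision

/-! ## The Nyström approximation -/

theorem IsMoorePenrose.transpose_eq {n : Type*} [Fintype n] {A X : Matrix n n ℝ}
    (h : IsMoorePenrose A X) (hA : Aᵀ = A) : Xᵀ = X := by
  refine IsMoorePenrose.unique (A := A) ⟨?_, ?_, ?_, ?_⟩ h
  · have := congrArg Matrix.transpose h.mul_mul_left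
    rwa [Matrix.transpose_mul, Matrix.transpose_mul, hA, ← Matrix.mul_assoc] at this
  · have := congrArg Matrix.transpose h.mul_mul_right
    rwa [Matrix.transpose_mul, Matrix.transpose_mul, hA, ← Matrix.mul_assoc] at this
  · have := h.symm_right
    rw [Matrix.transpose_mul, hA] at this
    rw [Matrix.transpose_mul, Matrix.transpose_transpose, hA, this]
  · have := h.symm_left
    rw [Matrix.transpose_mul, hA] at this
    rw [Matrix.transpose_mul, Matrix.transpose_transpose, hA, this]

section Nystrom

variable {m : ℕ} {A : Matrix (Fin m) (Fin m) ℝ}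

theorem selectionMatrix_transpose_mulVec (ω : Fin m → Bool) (y : Fin m → ℝ)
    (i : {i : Fin m // ω i = true}) : ((selectionMatrix ω)ᵀ *ᵥ y) i = y i := by
  simp [selectionMatrix, Matrix.mulVec, dotProduct, Matrix.one_apply]

theorem selectionMatrix_mulVec_coe (ω : Fin m → Bool) (y : {i : Fin m // ω i = true} → ℝ)
    (i : {i : Fin m // ω i = true}) : (selectionMatrix ω *ᵥ y) i = y i := by
  simp [selectionMatrix, Matrix.mulVec, dotProduct, Matrix.one_apply, Subtype.val_inj]

theorem selectionMatrix_mulVec_of_not (ω : Fin m → Bool) (y : {i : Fin m // ω i = true} → ℝ)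
    {i : Fin m} (hi : ω i ≠ true) : (selectionMatrix ω *ᵥ y) i = 0 := by
  rw [Matrix.mulVec, dotProduct]
  refine Finset.sum_eq_zero fun j _ => ?_
  have : i ≠ j := fun h => hi (h ▸ j.2)
  simp [selectionMatrix, this]

theorem selectionMatrix_gram_posSemidef (hA : A.PosSemidef) (ω : Fin m → Bool) :
    ((selectionMatrix ω)ᵀ * A * selectionMatrix ω).PosSemidef := by
  have := hA.conjTranspose_mul_mul_same (selectionMatrix ω)
  rwa [Matrix.conjTranspose_eq_transpose_of_trivial] at this

theorem sparsifier_mulVec (ω : Fin m → Bool) (x : Fin m → ℝ) :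
    sparsifier A ω *ᵥ x = selectionMatrix ω *ᵥ
      (pinv ((selectionMatrix ω)ᵀ * A * selectionMatrix ω) *ᵥ
        ((selectionMatrix ω)ᵀ *ᵥ (A *ᵥ x))) := by
  simp only [sparsifier, Matrix.mulVec_mulVec, Matrix.mul_assoc]

theorem sparsifier_mulVec_of_not (ω : Fin m → Bool) (x : Fin m → ℝ) {i : Fin m}
    (hi : ω i ≠ true) : (sparsifier A ω *ᵥ x) i = 0 := by
  rw [sparsifier_mulVec, selectionMatrix_mulVec_of_not ω _ hi]

theorem nystrom_mulVec (ω : Fin m → Bool) (x : Fin m → ℝ) :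
    nystrom A ω *ᵥ x = A *ᵥ (sparsifier A ω *ᵥ x) := by
  rw [nystrom, Matrix.mulVec_mulVec]

/-- On the selected indices, `A` agrees with its Nyström approximation. -/
theorem nystrom_mulVec_apply_of_selected (hA : A.PosSemidef) (ω : Fin m → Bool) (x : Fin m → ℝ)
    {i : Fin m} (hi : ω i = true) : (nystrom A ω *ᵥ x) i = (A *ᵥ x) i := by
  classical
  set S := selectionMatrix ω with hS
  set G := Sᵀ * A * S with hG
  have hGpsd : G.PosSemidef := selectionMatrix_gram_posSemidef hA ω
  have hMP := isMoorePenrose_pinv hGpsd.isHermitian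
  -- `G` may be singular, so it need not cancel against its pseudoinverse. The defect `E` is
  -- harmless: `E G E = 0` says that the `A`-energy of `S E y` is zero, hence `A S E = 0` by
  -- positive semidefiniteness.
  set E := 1 - G * pinv G with hE
  have hEG : E * G = 0 := by rw [hE, sub_mul, Matrix.one_mul, hMP.mul_mul_left, sub_self]
  have hET : Eᵀ = E := by rw [hE, Matrix.transpose_sub, Matrix.transpose_one, hMP.symm_left]
  have hASE : ∀ y, A *ᵥ (S *ᵥ (E *ᵥ y)) = 0 := by
    intro y
    rw [← hA.dotProduct_mulVec_zero_iff, star_trivial]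
    have h1 : (S *ᵥ (E *ᵥ y)) ⬝ᵥ A *ᵥ (S *ᵥ (E *ᵥ y)) = y ⬝ᵥ (E * G * E) *ᵥ y := by
      have h2 : E * G * E = (S * E)ᵀ * (A * (S * E)) := by
        rw [Matrix.transpose_mul, hET, hG]
        simp only [Matrix.mul_assoc]
      rw [h2, ← Matrix.mulVec_mulVec, Matrix.dotProduct_mulVec y, ← Matrix.mulVec_transpose,
        Matrix.transpose_transpose]
      simp only [Matrix.mulVec_mulVec]
    rw [h1, hEG, Matrix.zero_mul, Matrix.zero_mulVec, dotProduct_zero]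
  have hASE' : A * S * E = 0 := by
    refine Matrix.ext_of_mulVec_single fun j => ?_
    rw [Matrix.zero_mulVec, ← Matrix.mulVec_mulVec, ← Matrix.mulVec_mulVec]
    exact hASE _
  have hESA : E * Sᵀ * A = 0 := by
    have := congrArg Matrix.transpose hASE'
    rwa [Matrix.transpose_mul, Matrix.transpose_mul, hET, transpose_eq_of_posSemidef hA,
      Matrix.transpose_zero, ← Matrix.mul_assoc] at this
  have h : Sᵀ *ᵥ (nystrom A ω *ᵥ x) = Sᵀ *ᵥ (A *ᵥ x) := by
    rw [hE, Matrix.sub_mul, Matrix.sub_mul, Matrix.one_mul, sub_eq_zero] at hESA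
    rw [Matrix.mulVec_mulVec, Matrix.mulVec_mulVec, hESA]
    simp only [nystrom, sparsifier, ← hS, ← hG, Matrix.mul_assoc]
    rw [hG]
    simp only [Matrix.mul_assoc]
  have h' := congrFun h ⟨i, hi⟩
  rwa [selectionMatrix_transpose_mulVec, selectionMatrix_transpose_mulVec] at h'

/-- The sparsifier projects orthogonally for the form of `A`: its output lives on the selected
indices, and there `A` annihilates the residual. -/
theorem dotProduct_nystrom (hA : A.PosSemidef) (ω : Fin m → Bool) (x : Fin m → ℝ) :
    x ⬝ᵥ nystrom A ω *ᵥ x =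
      sparsifier A ω *ᵥ x ⬝ᵥ A *ᵥ (sparsifier A ω *ᵥ x) := by
  have h1 : sparsifier A ω *ᵥ x ⬝ᵥ A *ᵥ (sparsifier A ω *ᵥ x) =
      sparsifier A ω *ᵥ x ⬝ᵥ A *ᵥ x := by
    refine Finset.sum_congr rfl fun i _ => ?_
    by_cases hi : ω i = true
    · rw [← nystrom_mulVec, nystrom_mulVec_apply_of_selected hA ω x hi]
    · rw [sparsifier_mulVec_of_not ω x hi, zero_mul, zero_mul]
  rw [h1, nystrom_mulVec,
    dotProduct_mulVec_comm_of_transpose_eq (transpose_eq_of_posSemidef hA), dotProduct_comm]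

theorem dotProduct_residual (hA : A.PosSemidef) (ω : Fin m → Bool) (x : Fin m → ℝ) :
    (x - sparsifier A ω *ᵥ x) ⬝ᵥ A *ᵥ (x - sparsifier A ω *ᵥ x) =
      x ⬝ᵥ A *ᵥ (x - sparsifier A ω *ᵥ x) := by
  have h1 : sparsifier A ω *ᵥ x ⬝ᵥ A *ᵥ (x - sparsifier A ω *ᵥ x) = 0 := by
    refine Finset.sum_eq_zero fun i _ => ?_
    by_cases hi : ω i = true
    · rw [Matrix.mulVec_sub, Pi.sub_apply, ← nystrom_mulVec,
        nystrom_mulVec_apply_of_selected hA ω x hi, sub_self, mul_zero]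
    · rw [sparsifier_mulVec_of_not ω x hi, zero_mul]
  rw [sub_dotProduct, h1, sub_zero]

theorem dotProduct_nystrom_nonneg (hA : A.PosSemidef) (ω : Fin m → Bool) (x : Fin m → ℝ) :
    0 ≤ x ⬝ᵥ nystrom A ω *ᵥ x := by
  rw [dotProduct_nystrom hA]
  exact posSemidef_dotProduct_nonneg hA _

theorem dotProduct_nystrom_le (hA : A.PosSemidef) (ω : Fin m → Bool) (x : Fin m → ℝ) :
    x ⬝ᵥ nystrom A ω *ᵥ x ≤ x ⬝ᵥ A *ᵥ x := by
  have h := posSemidef_dotProduct_nonneg hA (x - sparsifier A ω *ᵥ x)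
  rw [dotProduct_residual hA, Matrix.mulVec_sub, dotProduct_sub, ← nystrom_mulVec] at h
  linarith

theorem dotProduct_sq_le {n : Type*} [Fintype n] (x y : n → ℝ) :
    (x ⬝ᵥ y) ^ 2 ≤ (x ⬝ᵥ x) * (y ⬝ᵥ y) := by
  have := Finset.sum_mul_sq_le_sq_mul_sq Finset.univ x y
  simpa [dotProduct, sq] using this

theorem dotProduct_self_nonneg' {n : Type*} [Fintype n] (x : n → ℝ) : 0 ≤ x ⬝ᵥ x :=
  Finset.sum_nonneg fun _ _ => mul_self_nonneg _

/-- For a good selection, the Nyström approximation loses at most `μ / 2`. -/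
theorem IsGoodSelection.dotProduct_le (hA : A.PosSemidef) {μ : ℝ} (hμ : 0 ≤ μ)
    {ω : Fin m → Bool} (h : IsGoodSelection A μ ω) (x : Fin m → ℝ) :
    x ⬝ᵥ A *ᵥ x ≤ x ⬝ᵥ nystrom A ω *ᵥ x + μ / 2 * (x ⬝ᵥ x) := by
  set r := x - sparsifier A ω *ᵥ x with hr
  have h1 := h r (fun i hi => by
    rw [hr, Matrix.mulVec_sub, Pi.sub_apply, ← nystrom_mulVec,
      nystrom_mulVec_apply_of_selected hA ω x hi, sub_self])
  have h2 : r ⬝ᵥ A *ᵥ r = x ⬝ᵥ A *ᵥ r := dotProduct_residual hA ω x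
  have h3 : x ⬝ᵥ A *ᵥ r = x ⬝ᵥ A *ᵥ x - x ⬝ᵥ nystrom A ω *ᵥ x := by
    rw [hr, Matrix.mulVec_sub, dotProduct_sub, ← nystrom_mulVec]
  have h4 := dotProduct_sq_le x (A *ᵥ r)
  set q := x ⬝ᵥ A *ᵥ r
  have hx := dotProduct_self_nonneg' x
  -- Cauchy–Schwarz for `q = x · A r`, where goodness bounds `|A r|²` by `(μ/2) q`, since `q` is
  -- also the energy of `r`.
  have h5 : q * q ≤ q * (μ / 2 * (x ⬝ᵥ x)) := by
    rw [h2] at h1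
    nlinarith [mul_le_mul_of_nonneg_left h1 hx]
  have h6 : q ≤ μ / 2 * (x ⬝ᵥ x) := by
    by_contra! hlt
    have hq : 0 < q := lt_of_le_of_lt (by positivity) hlt
    exact hlt.not_ge (le_of_mul_le_mul_left h5 hq)
  linarith

theorem nystrom_posSemidef (hA : A.PosSemidef) (ω : Fin m → Bool) :
    (nystrom A ω).PosSemidef := by
  refine Matrix.PosSemidef.of_dotProduct_mulVec_nonneg ?_ fun x => ?_
  · have hG := selectionMatrix_gram_posSemidef hA ω
    have h1 := (isMoorePenrose_pinv hG.isHermitian).transpose_eq (transpose_eq_of_posSemidef hG)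
    rw [Matrix.IsHermitian, Matrix.conjTranspose_eq_transpose_of_trivial, nystrom, sparsifier]
    simp only [Matrix.transpose_mul, Matrix.transpose_transpose, transpose_eq_of_posSemidef hA,
      Matrix.mul_assoc] at h1 ⊢
    rw [h1]
  · rw [star_trivial]
    exact dotProduct_nystrom_nonneg hA ω x

/-- Selected indices with equal rows of `A` receive equal coefficients. -/
theorem sparsifier_mulVec_eq (hA : A.PosSemidef) (ω : Fin m → Bool) (x : Fin m → ℝ) {i j : Fin m}
    (hi : ω i = true) (hj : ω j = true) (hij : A i = A j) :
    (sparsifier A ω *ᵥ x) i = (sparsifier A ω *ᵥ x) j := by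
  set G := (selectionMatrix ω)ᵀ * A * selectionMatrix ω with hG
  have hGpsd : G.PosSemidef := selectionMatrix_gram_posSemidef hA ω
  have hMP := isMoorePenrose_pinv hGpsd.isHermitian
  have hGT := transpose_eq_of_posSemidef hGpsd
  -- The range of `G†` lies in that of the symmetric matrix `G`, and vectors `G y` have equal
  -- entries at equal rows.
  have h1 : pinv G = G * (pinv G * pinv G) := by
    have h2 := hMP.symm_right
    rw [Matrix.transpose_mul, hGT, hMP.transpose_eq hGT] at h2
    conv_lhs => rw [← hMP.mul_mul_right]
    rw [← h2, Matrix.mul_assoc]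
  have h3 : ∀ y, (G *ᵥ y) ⟨i, hi⟩ = (G *ᵥ y) ⟨j, hj⟩ := by
    intro y
    rw [hG, ← Matrix.mulVec_mulVec, ← Matrix.mulVec_mulVec, selectionMatrix_transpose_mulVec,
      selectionMatrix_transpose_mulVec]
    change A i ⬝ᵥ _ = A j ⬝ᵥ _
    rw [hij]
  rw [sparsifier_mulVec, ← hG, h1, ← Matrix.mulVec_mulVec]
  have h4 := selectionMatrix_mulVec_coe ω (G *ᵥ ((pinv G * pinv G) *ᵥ
    ((selectionMatrix ω)ᵀ *ᵥ (A *ᵥ x))))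
  rw [h4 ⟨i, hi⟩, h4 ⟨j, hj⟩, h3]

/-! ### Ridge regression with the Nyström approximation -/

theorem nystrom_mulVec_ridgeSolution (hA : A.PosSemidef) (ω : Fin m → Bool) {lam : ℝ}
    (hlam : 0 < lam * m) (Y : Fin m → ℝ) :
    nystrom A ω *ᵥ ridgeSolution A ω lam Y = Y - (lam * m) • ridgeSolution A ω lam Y := by
  rw [eq_sub_iff_add_eq]
  have h := add_smul_one_mul_inv (nystrom_posSemidef hA ω) hlam
  have h2 : (nystrom A ω + (lam * m) • (1 : Matrix (Fin m) (Fin m) ℝ)) *ᵥ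
      ridgeSolution A ω lam Y = Y := by
    rw [ridgeSolution, Matrix.mulVec_mulVec, h, Matrix.one_mulVec]
  rwa [Matrix.add_mulVec, Matrix.smul_mulVec, Matrix.one_mulVec] at h2

theorem mulVec_sparseSolution (ω : Fin m → Bool) (lam : ℝ) (Y : Fin m → ℝ) :
    A *ᵥ sparseSolution A ω lam Y = nystrom A ω *ᵥ ridgeSolution A ω lam Y := by
  rw [sparseSolution, nystrom_mulVec]

theorem dotProduct_ridgeSolution (hA : A.PosSemidef) (ω : Fin m → Bool) {lam : ℝ}
    (hlam : 0 < lam * m) (Y : Fin m → ℝ) :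
    ridgeSolution A ω lam Y ⬝ᵥ Y =
      ridgeSolution A ω lam Y ⬝ᵥ nystrom A ω *ᵥ ridgeSolution A ω lam Y +
        lam * m * (ridgeSolution A ω lam Y ⬝ᵥ ridgeSolution A ω lam Y) := by
  rw [nystrom_mulVec_ridgeSolution hA ω hlam, dotProduct_sub, dotProduct_smul, smul_eq_mul]
  ring

/-- The fitted values and the scaled dual solution are no longer than the labels. -/
theorem ridgeSolution_bounds (hA : A.PosSemidef) (ω : Fin m → Bool) {lam : ℝ}
    (hlam : 0 < lam * m) (Y : Fin m → ℝ) :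
    A *ᵥ sparseSolution A ω lam Y ⬝ᵥ A *ᵥ sparseSolution A ω lam Y ≤ Y ⬝ᵥ Y ∧
      (lam * m) ^ 2 * (ridgeSolution A ω lam Y ⬝ᵥ ridgeSolution A ω lam Y) ≤ Y ⬝ᵥ Y := by
  rw [mulVec_sparseSolution]
  have h1 := dotProduct_nystrom_nonneg hA ω (ridgeSolution A ω lam Y)
  have h2 := nystrom_mulVec_ridgeSolution hA ω hlam Y
  set a := ridgeSolution A ω lam Y
  set f := nystrom A ω *ᵥ a
  have h3 : Y = f + (lam * m) • a := by rw [h2]; abel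
  have h4 : Y ⬝ᵥ Y = f ⬝ᵥ f + 2 * (lam * m) * (a ⬝ᵥ f) + (lam * m) ^ 2 * (a ⬝ᵥ a) := by
    rw [h3]
    simp only [add_dotProduct, dotProduct_add, smul_dotProduct, dotProduct_smul, smul_eq_mul,
      dotProduct_comm f a]
    ring
  have h5 := dotProduct_self_nonneg' f
  have h6 := dotProduct_self_nonneg' a
  constructor <;> nlinarith [mul_nonneg hlam.le h1, mul_nonneg (sq_nonneg (lam * m)) h6]

/-- With `ν = lam m`, the residual is `-ν a`, so its square is at most `ν a·Y`. Split `Y = (Y - h) +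
h` and apply Young's inequality to both parts; `hh` is that inequality for `h` of squared norm at
most `B`. The terms quadratic in `a` are absorbed into `a·Y`, at the price of the factor `κ` that
compensates for replacing `K̄` by `A`. -/
theorem dotProduct_sub_ridge_le (hA : A.PosSemidef) {μ : ℝ} (hμ : 0 ≤ μ) {ω : Fin m → Bool}
    (hω : IsGoodSelection A μ ω) {lam : ℝ} (hlam : 0 < lam * m) (Y h : Fin m → ℝ) (B : ℝ)
    (hh : ∀ κ : ℝ, 0 < κ → ∀ a, 2 * (h ⬝ᵥ a) ≤ κ * B + (a ⬝ᵥ A *ᵥ a) / κ) :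
    (A *ᵥ sparseSolution A ω lam Y - Y) ⬝ᵥ (A *ᵥ sparseSolution A ω lam Y - Y) ≤
      (1 + μ / (2 * (lam * m))) * ((h - Y) ⬝ᵥ (h - Y) + lam * m * B) := by
  rw [mulVec_sparseSolution]
  have h1 := hω.dotProduct_le hA hμ (ridgeSolution A ω lam Y)
  have h2 := nystrom_mulVec_ridgeSolution hA ω hlam Y
  have h3 := dotProduct_ridgeSolution hA ω hlam Y
  have h0 := dotProduct_nystrom_nonneg hA ω (ridgeSolution A ω lam Y)
  set a := ridgeSolution A ω lam Y
  set ν := lam * m with hν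
  set κ := 1 + μ / (2 * ν) with hκ
  have hκ0 : 0 < κ := by positivity
  have h4 := hh κ hκ0 a
  have ha := dotProduct_self_nonneg' a
  have h5 : nystrom A ω *ᵥ a - Y = (-ν) • a := by rw [h2]; simp
  have h6 : 2 * ((Y - h) ⬝ᵥ a) ≤ κ * ((h - Y) ⬝ᵥ (h - Y)) / ν + ν * (a ⬝ᵥ a) / κ := by
    have h7 := dotProduct_self_nonneg' (κ • (Y - h) - ν • a)
    have h8 : (κ • (Y - h) - ν • a) ⬝ᵥ (κ • (Y - h) - ν • a) =
        κ ^ 2 * ((h - Y) ⬝ᵥ (h - Y)) - 2 * κ * ν * ((Y - h) ⬝ᵥ a) + ν ^ 2 * (a ⬝ᵥ a) := by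
      have e : h - Y = -(Y - h) := by abel
      rw [e]
      simp only [sub_dotProduct, dotProduct_sub, smul_dotProduct, dotProduct_smul, smul_eq_mul,
        neg_dotProduct, dotProduct_neg, dotProduct_comm a]
      ring
    rw [h8] at h7
    rw [div_add_div _ _ hlam.ne' hκ0.ne', le_div_iff₀ (mul_pos hlam hκ0)]
    nlinarith
  have h9 : a ⬝ᵥ Y = (Y - h) ⬝ᵥ a + h ⬝ᵥ a := by
    rw [sub_dotProduct, dotProduct_comm a]; ring
  have h10 : (ν * (a ⬝ᵥ a) + a ⬝ᵥ A *ᵥ a) / κ ≤ a ⬝ᵥ Y := by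
    rw [div_le_iff₀ hκ0]
    have e : a ⬝ᵥ Y * κ = a ⬝ᵥ Y + μ / (2 * ν) * (a ⬝ᵥ Y) := by rw [hκ]; ring
    have h11 : μ / 2 * (a ⬝ᵥ a) ≤ μ / (2 * ν) * (a ⬝ᵥ Y) := by
      have h12 : μ / 2 * (a ⬝ᵥ a) = μ / (2 * ν) * (ν * (a ⬝ᵥ a)) := by
        field_simp
      rw [h12]
      refine mul_le_mul_of_nonneg_left ?_ (by positivity)
      linarith
    rw [e]
    linarith
  have h13 : a ⬝ᵥ Y ≤ κ * ((h - Y) ⬝ᵥ (h - Y)) / ν + κ * B := by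
    rw [add_div] at h10
    linarith
  have h14 : ν * (a ⬝ᵥ Y) ≤ κ * ((h - Y) ⬝ᵥ (h - Y) + ν * B) := by
    refine (mul_le_mul_of_nonneg_left h13 hlam.le).trans (le_of_eq ?_)
    field_simp
  rw [h5, smul_dotProduct, dotProduct_smul, smul_eq_mul, smul_eq_mul]
  nlinarith

end Nystrom

/-! ## Accuracy of the truncated coefficients -/

theorem clip01_nonneg (t : ℝ) : 0 ≤ clip01 t := le_max_left _ _

theorem clip01_le_one (t : ℝ) : clip01 t ≤ 1 := max_le zero_le_one (min_le_left _ _)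

theorem clip01_eq_self {t : ℝ} (h0 : 0 ≤ t) (h1 : t ≤ 1) : clip01 t = t := by
  rw [clip01, min_eq_right h1, max_eq_right h0]

theorem abs_clip01_sub_le (s t : ℝ) : |clip01 s - clip01 t| ≤ |s - t| := by
  rw [clip01, clip01]
  refine (abs_max_sub_max_le_max _ _ _ _).trans (max_le (by simp) ?_)
  exact (abs_min_sub_min_le_max _ _ _ _).trans (max_le (by simp) le_rfl)

theorem clip01_sub_sq_le {f g y e : ℝ} (hy0 : 0 ≤ y) (hy1 : y ≤ 1) (h : |g - f| ≤ e) :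
    (clip01 g - y) ^ 2 ≤ (f - y) ^ 2 + 2 * e := by
  have h1 := abs_clip01_sub_le f y
  rw [clip01_eq_self hy0 hy1] at h1
  have h2 := sq_le_sq.2 h1
  have h3 := (abs_clip01_sub_le g f).trans h
  rw [abs_le] at h3
  have := clip01_nonneg f
  have := clip01_le_one f
  have := clip01_nonneg g
  have := clip01_le_one g
  have h4 : (clip01 g - clip01 f) * (clip01 g + clip01 f - 2 * y) ≤ 2 * e := by
    rcases le_total 0 (clip01 g + clip01 f - 2 * y) with h | h <;> nlinarith
  nlinarith

theorem clip01_sub_sq_le_one {y : ℝ} (hy0 : 0 ≤ y) (hy1 : y ≤ 1) (t : ℝ) :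
    (clip01 t - y) ^ 2 ≤ 1 := by
  have := clip01_nonneg t
  have := clip01_le_one t
  nlinarith

section Accuracy

variable {X : Type*} {m : ℕ} {A K : Matrix (Fin m) (Fin m) ℝ} {x : Fin m → X} {η : ℝ}

theorem sparseSolution_eq (hA : A.PosSemidef) (hrow : ∀ i j, x i = x j → A i = A j)
    (ω : Fin m → Bool) (lam : ℝ) (Y : Fin m → ℝ) (i j : Fin m) (hij : x i = x j)
    (hi : sparseSolution A ω lam Y i ≠ 0) (hj : sparseSolution A ω lam Y j ≠ 0) :
    sparseSolution A ω lam Y i = sparseSolution A ω lam Y j := by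
  refine sparsifier_mulVec_eq hA ω _ ?_ ?_ (hrow i j hij)
  · by_contra h
    exact hi (sparsifier_mulVec_of_not ω _ h)
  · by_contra h
    exact hj (sparsifier_mulVec_of_not ω _ h)

/-- Nonzero coefficients of the same point agree, so all cross terms on the right are nonnegative.
-/
theorem dotProduct_self_le_collision {α : Fin m → ℝ}
    (hα : ∀ i j, x i = x j → α i ≠ 0 → α j ≠ 0 → α i = α j) :
    α ⬝ᵥ α ≤ α ⬝ᵥ collision x *ᵥ α := by
  classical
  refine Finset.sum_le_sum fun i _ => ?_
  rw [collision_mulVec, Finset.mul_sum]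
  refine Finset.single_le_sum (f := fun j => α i * α j) (fun j hj => ?_)
    (Finset.mem_filter.2 ⟨Finset.mem_univ i, rfl⟩)
  by_cases hi : α i = 0
  · simp [hi]
  by_cases hj0 : α j = 0
  · simp [hj0]
  change 0 ≤ α i * α j
  rw [hα i j (Finset.mem_filter.1 hj).2.symm hi hj0]
  exact mul_self_nonneg _

theorem abs_dotProduct_collision {α : Fin m → ℝ}
    (hα : ∀ i j, x i = x j → α i ≠ 0 → α j ≠ 0 → α i = α j) :
    (fun i => |α i|) ⬝ᵥ collision x *ᵥ (fun i => |α i|) = α ⬝ᵥ collision x *ᵥ α := by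
  classical
  refine Finset.sum_congr rfl fun i _ => ?_
  rw [collision_mulVec, collision_mulVec, Finset.mul_sum, Finset.mul_sum]
  refine Finset.sum_congr rfl fun j hj => ?_
  by_cases hi : α i = 0
  · simp [hi]
  by_cases hj0 : α j = 0
  · simp [hj0]
  change |α i| * |α j| = _
  rw [hα i j (Finset.mem_filter.1 hj).2.symm hi hj0, abs_mul_abs_self]

theorem dotProduct_self_le_card {Y : Fin m → ℝ} (hY0 : ∀ i, 0 ≤ Y i) (hY1 : ∀ i, Y i ≤ 1) :
    Y ⬝ᵥ Y ≤ m := by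
  have : Y ⬝ᵥ Y ≤ ∑ _i : Fin m, (1 : ℝ) :=
    Finset.sum_le_sum fun i _ => by nlinarith [hY0 i, hY1 i]
  simpa using this

/-- The coefficients are at most `√m / η`. -/
theorem sq_sparseSolution_le (hA : A.PosSemidef) (hrow : ∀ i j, x i = x j → A i = A j)
    (hAx : ∀ z, η * (z ⬝ᵥ collision x *ᵥ z) ≤ z ⬝ᵥ A *ᵥ z) (hη : 0 < η) (ω : Fin m → Bool)
    {lam : ℝ} (hlam : 0 < lam * m) {Y : Fin m → ℝ} (hY0 : ∀ i, 0 ≤ Y i) (hY1 : ∀ i, Y i ≤ 1)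
    (i : Fin m) : (η * sparseSolution A ω lam Y i) ^ 2 ≤ m := by
  have h1 := (ridgeSolution_bounds hA ω hlam Y).1.trans (dotProduct_self_le_card hY0 hY1)
  have h2 := dotProduct_self_le_collision (sparseSolution_eq hA hrow ω lam Y)
  set α := sparseSolution A ω lam Y
  have h3 := hAx α
  have h4 := dotProduct_sq_le α (A *ᵥ α)
  have h5 : α i ^ 2 ≤ α ⬝ᵥ α := by
    rw [sq]
    exact Finset.single_le_sum (f := fun j => α j * α j) (fun j _ => mul_self_nonneg _)
      (Finset.mem_univ i)
  rw [mul_pow]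
  rcases eq_or_lt_of_le (dotProduct_self_nonneg' α) with h0 | h0
  · have : α i ^ 2 = 0 := le_antisymm (h5.trans h0.symm.le) (sq_nonneg _)
    rw [this, mul_zero]
    exact Nat.cast_nonneg m
  have h6 : η * (α ⬝ᵥ α) ≤ α ⬝ᵥ A *ᵥ α := (mul_le_mul_of_nonneg_left h2 hη.le).trans h3
  have h7 : (η * (α ⬝ᵥ α)) ^ 2 ≤ (α ⬝ᵥ α) * m :=
    (pow_le_pow_left₀ (by positivity) h6 2).trans
      (h4.trans (mul_le_mul_of_nonneg_left h1 h0.le))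
  have h8 : (α ⬝ᵥ α) * (η ^ 2 * (α ⬝ᵥ α)) ≤ (α ⬝ᵥ α) * m := by nlinarith
  exact (mul_le_mul_of_nonneg_left h5 (sq_nonneg η)).trans (le_of_mul_le_mul_left h8 h0)

theorem dotProduct_mulVec_le_card {b : ℝ} (hb : ∀ i j, |A i j| ≤ b) (hb0 : 0 ≤ b)
    (a : Fin m → ℝ) : a ⬝ᵥ A *ᵥ a ≤ b * m * (a ⬝ᵥ a) := by
  have h1 : a ⬝ᵥ A *ᵥ a ≤ b * (∑ i, |a i|) ^ 2 := by
    rw [sq, Finset.sum_mul_sum, Finset.mul_sum]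
    refine Finset.sum_le_sum fun i _ => ?_
    rw [Matrix.mulVec, dotProduct, Finset.mul_sum, Finset.mul_sum]
    refine Finset.sum_le_sum fun j _ => ?_
    calc a i * (A i j * a j) ≤ |a i * (A i j * a j)| := le_abs_self _
      _ = |A i j| * (|a i| * |a j|) := by rw [abs_mul, abs_mul]; ring
      _ ≤ b * (|a i| * |a j|) := by gcongr; exact hb i j
  have h2 : (∑ i, |a i|) ^ 2 ≤ m * (a ⬝ᵥ a) := by
    refine sq_sum_le_card_mul_sum_sq.trans (le_of_eq ?_)
    simp [dotProduct, sq]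
  rw [mul_assoc]
  exact h1.trans (mul_le_mul_of_nonneg_left h2 hb0)

theorem abs_mulVec_le {b : ℝ} (hb : ∀ i j, |K i j| ≤ b) (δ : Fin m → ℝ) (i : Fin m) :
    |(K *ᵥ δ) i| ≤ b * ∑ j, |δ j| := by
  rw [Matrix.mulVec, dotProduct, Finset.mul_sum]
  refine (Finset.abs_sum_le_sum_abs _ _).trans (Finset.sum_le_sum fun j _ => ?_)
  rw [abs_mul]
  exact mul_le_mul_of_nonneg_right (hb i j) (abs_nonneg _)

theorem abs_collision_le (i j : Fin m) : |collision x i j| ≤ 1 := by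
  rw [collision, Matrix.of_apply]
  split_ifs <;> simp

/-- Truncating the coefficients changes the fitted values by at most `3 ε / 8`. -/
theorem abs_mulVec_truncation_le {ε B M : ℝ} (hε : 0 < ε) (hB : 0 < B) (hM : 0 < M)
    (hm : 0 < m) (hK : K.PosSemidef) (hKM : ∀ i j, |K i j| ≤ M)
    (hη : η = etaParam ε B) (hAK : A = K + η • collision x)
    (hrow : ∀ i j, x i = x j → A i = A j) (ω : Fin m → Bool)
    {Y : Fin m → ℝ} (hY0 : ∀ i, 0 ≤ Y i) (hY1 : ∀ i, Y i ≤ 1) (δ : Fin m → ℝ)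
    (hδ : ∀ i, |δ i| ≤ |sparseSolution A ω (lambdaParam ε B) Y i|)
    (hδs : ∑ i, |δ i| ≤ ε / (4 * M)) (i : Fin m) : |(A *ᵥ δ) i| ≤ 3 * ε / 8 := by
  classical
  have hη0 : 0 < η := by rw [hη, etaParam]; positivity
  have hA : A.PosSemidef := by rw [hAK]; exact hK.add ((collision_posSemidef x).smul hη0.le)
  have hm' : 0 < (m : ℝ) := by exact_mod_cast hm
  have h1 := abs_mulVec_le hKM δ i
  have h2 : M * ∑ j, |δ j| ≤ ε / 4 := by
    refine (mul_le_mul_of_nonneg_left hδs hM.le).trans (le_of_eq ?_)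
    field_simp
  have h3 : |η * (collision x *ᵥ δ) i| ≤ ε / 8 := by
    rw [abs_mul, abs_of_pos hη0]
    -- The precision is adapted to `M` only. If `η` is larger, rounding towards zero helps: the
    -- error is dominated by the coefficients themselves, whose sum over the copies of a point is
    -- already small enough.
    rcases le_total η (M / 2) with hηM | hηM
    · have h4 := abs_mulVec_le (K := collision x) abs_collision_le δ i
      rw [one_mul] at h4
      calc η * |(collision x *ᵥ δ) i| ≤ M / 2 * (ε / (4 * M)) := by
            refine mul_le_mul hηM (h4.trans hδs) (abs_nonneg _) (by positivity)
        _ = ε / 8 := by field_simp; norm_num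
    · set lam := lambdaParam ε B with hlamdef
      have hlam0 : 0 < lam := by rw [hlamdef, lambdaParam]; positivity
      have hlam : 0 < lam * m := by positivity
      have h4 := (ridgeSolution_bounds hA ω hlam Y).2.trans (dotProduct_self_le_card hY0 hY1)
      have h5 := abs_dotProduct_collision (sparseSolution_eq hA hrow ω lam Y)
      have h6 := collision_mulVec_sq_le x (fun i => |sparseSolution A ω lam Y i|) i
      rw [h5] at h6
      have h7 : η * (sparseSolution A ω lam Y ⬝ᵥ collision x *ᵥ sparseSolution A ω lam Y) ≤
          sparseSolution A ω lam Y ⬝ᵥ A *ᵥ sparseSolution A ω lam Y := by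
        have := posSemidef_dotProduct_nonneg hK (sparseSolution A ω lam Y)
        rw [hAK, Matrix.add_mulVec, dotProduct_add, Matrix.smul_mulVec, dotProduct_smul,
          smul_eq_mul, ← hAK]
        linarith
      -- In this case `M ≤ 2 η`, so the entries of `A` are at most `3 η`.
      have h8 : sparseSolution A ω lam Y ⬝ᵥ A *ᵥ sparseSolution A ω lam Y ≤
          3 * η * m * (ridgeSolution A ω lam Y ⬝ᵥ ridgeSolution A ω lam Y) := by
        rw [sparseSolution, ← dotProduct_nystrom hA]
        refine (dotProduct_nystrom_le hA ω _).trans (dotProduct_mulVec_le_card ?_ (by positivity) _)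
        intro i j
        rw [hAK, Matrix.add_apply, Matrix.smul_apply, smul_eq_mul]
        refine (abs_add_le _ _).trans ?_
        rw [abs_mul, abs_of_pos hη0]
        have := hKM i j
        have := mul_le_mul_of_nonneg_left (abs_collision_le (x := x) i j) hη0.le
        linarith
      set s := (collision x *ᵥ fun i => |sparseSolution A ω lam Y i|) i with hs
      have h9 : |(collision x *ᵥ δ) i| ≤ s := by
        rw [hs, collision_mulVec, collision_mulVec]
        exact (Finset.abs_sum_le_sum_abs _ _).trans (Finset.sum_le_sum fun j _ => hδ j)
      set e := sparseSolution A ω lam Y ⬝ᵥ collision x *ᵥ sparseSolution A ω lam Y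
      set a := ridgeSolution A ω lam Y ⬝ᵥ ridgeSolution A ω lam Y
      have h10 : e ≤ 3 * m * a := by
        refine le_of_mul_le_mul_left ?_ hη0
        linarith
      have h11 : lam ^ 2 * (m * a) ≤ 1 := by
        refine le_of_mul_le_mul_left ?_ hm'
        linarith
      have h12 : (lam * s) ^ 2 ≤ 3 := by
        rw [mul_pow]
        nlinarith [mul_le_mul_of_nonneg_left (h6.trans h10) (sq_nonneg lam)]
      have h13 : lam * s ≤ 2 := by nlinarith
      have h14 : η = ε / 18 * lam := by
        rw [hη, hlamdef, etaParam, lambdaParam]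
        field_simp
        norm_num
      calc η * |(collision x *ᵥ δ) i| ≤ η * s := by gcongr
        _ = ε / 18 * (lam * s) := by rw [h14]; ring
        _ ≤ ε / 18 * 2 := by gcongr
        _ ≤ ε / 8 := by linarith
  have h4 : (A *ᵥ δ) i = (K *ᵥ δ) i + η * (collision x *ᵥ δ) i := by
    rw [hAK, Matrix.add_mulVec, Pi.add_apply, Matrix.smul_mulVec, Pi.smul_apply, smul_eq_mul]
  rw [h4]
  refine (abs_add_le _ _).trans ?_
  linarith

/-- For a good selection, the clipped predictions compete with every `h` of the class. -/
theorem sum_clip01_sub_sq_le {ε B M : ℝ} (hε : 0 < ε) (hB : 0 < B) (hM : 0 < M)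
    (hm : 0 < m) (hK : K.PosSemidef) (hKM : ∀ i j, |K i j| ≤ M)
    (hη : η = etaParam ε B) (hAK : A = K + η • collision x)
    (hrow : ∀ i j, x i = x j → A i = A j) {ω : Fin m → Bool}
    (hω : IsGoodSelection A (η * m) ω)
    {Y : Fin m → ℝ} (hY0 : ∀ i, 0 ≤ Y i) (hY1 : ∀ i, Y i ≤ 1) (β : Fin m → ℝ)
    (hβ : ∀ i, |β i - sparseSolution A ω (lambdaParam ε B) Y i| ≤
      |sparseSolution A ω (lambdaParam ε B) Y i|)
    (hβs : ∑ i, |β i - sparseSolution A ω (lambdaParam ε B) Y i| ≤ ε / (4 * M))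
    (h : Fin m → ℝ)
    (hh : ∀ κ : ℝ, 0 < κ → ∀ a, 2 * (h ⬝ᵥ a) ≤ κ * B + (a ⬝ᵥ A *ᵥ a) / κ) :
    (1 / (m : ℝ)) * ∑ i, (clip01 ((A *ᵥ β) i) - Y i) ^ 2 ≤
      (1 / (m : ℝ)) * ∑ i, (h i - Y i) ^ 2 + ε := by
  have hη0 : 0 < η := by rw [hη, etaParam]; positivity
  have hA : A.PosSemidef := by rw [hAK]; exact hK.add ((collision_posSemidef x).smul hη0.le)
  have hm' : 0 < (m : ℝ) := by exact_mod_cast hm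
  have hloss0 : 0 ≤ (1 / (m : ℝ)) * ∑ i, (h i - Y i) ^ 2 := by positivity
  have hone : (1 / (m : ℝ)) * ∑ i, (clip01 ((A *ᵥ β) i) - Y i) ^ 2 ≤ 1 := by
    rw [one_div, inv_mul_le_iff₀ hm', mul_one]
    have : ∑ i, (clip01 ((A *ᵥ β) i) - Y i) ^ 2 ≤ ∑ _i : Fin m, (1 : ℝ) :=
      Finset.sum_le_sum fun i _ => clip01_sub_sq_le_one (hY0 i) (hY1 i) _
    simpa using this
  -- Clipped predictions have loss at most `1`, so only `ε < 1` and a loss of `h` below `1` need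
  -- work.
  by_cases hε1 : 1 ≤ ε
  · linarith
  by_cases hl : 1 ≤ (1 / (m : ℝ)) * ∑ i, (h i - Y i) ^ 2
  · linarith
  push Not at hε1 hl
  set lam := lambdaParam ε B with hlamdef
  have hlam0 : 0 < lam := by rw [hlamdef, lambdaParam]; positivity
  have hlam : 0 < lam * m := by positivity
  set α := sparseSolution A ω lam Y with hα
  have h1 := dotProduct_sub_ridge_le hA (by positivity) hω hlam Y h B hh
  rw [← hα] at h1
  have h2 : ∀ i, |(A *ᵥ β) i - (A *ᵥ α) i| ≤ 3 * ε / 8 := by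
    intro i
    have := abs_mulVec_truncation_le hε hB hM hm hK hKM hη hAK hrow ω hY0 hY1 (β - α) hβ hβs i
    rwa [Matrix.mulVec_sub] at this
  have h3 : ∑ i, (clip01 ((A *ᵥ β) i) - Y i) ^ 2 ≤
      (A *ᵥ α - Y) ⬝ᵥ (A *ᵥ α - Y) + m * (3 * ε / 4) := by
    have e : (A *ᵥ α - Y) ⬝ᵥ (A *ᵥ α - Y) + m * (3 * ε / 4) =
        ∑ i, (((A *ᵥ α) i - Y i) ^ 2 + 2 * (3 * ε / 8)) := by
      rw [Finset.sum_add_distrib, dotProduct]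
      simp only [Pi.sub_apply, sq, Finset.sum_const, Finset.card_univ, Fintype.card_fin,
        nsmul_eq_mul]
      ring
    rw [e]
    exact Finset.sum_le_sum fun i _ => clip01_sub_sq_le (hY0 i) (hY1 i) (h2 i)
  have h4 : (h - Y) ⬝ᵥ (h - Y) = ∑ i, (h i - Y i) ^ 2 := by simp [dotProduct, sq]
  have h5 : η * m / (2 * (lam * m)) = ε / 36 := by
    rw [hη, hlamdef, etaParam, lambdaParam]
    field_simp
    norm_num
  have h6 : lam * B = ε ^ 2 / 324 := by
    rw [hlamdef, lambdaParam]
    field_simp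
  rw [h4, h5] at h1
  set loss := (1 / (m : ℝ)) * ∑ i, (h i - Y i) ^ 2 with hlossdef
  have h7 : ∑ i, (h i - Y i) ^ 2 = m * loss := by
    rw [hlossdef]
    field_simp
  rw [h7] at h1
  rw [one_div, inv_mul_le_iff₀ hm']
  refine h3.trans ?_
  have h8 : (1 + ε / 36) * (m * loss + lam * m * B) =
      m * ((1 + ε / 36) * (loss + ε ^ 2 / 324)) := by
    rw [← h6]; ring
  rw [h8] at h1
  -- The other `3 ε / 4` is the truncation error `3 ε / 8`, doubled by passing to squares.
  have h9 : (1 + ε / 36) * (loss + ε ^ 2 / 324) ≤ loss + ε / 4 := by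
    have : ε ^ 2 ≤ ε := by nlinarith
    nlinarith
  have h10 := mul_le_mul_of_nonneg_left h9 hm'.le
  linarith

end Accuracy

/-! ## The binary encoding -/

theorem length_encodeInt (w : ℕ) (q : ℤ) : (encodeInt w q).length = w + 1 := by
  simp [encodeInt]

theorem length_flatMap_of_forall {α β : Type*} (f : α → List β) {k : ℕ}
    (hf : ∀ a, (f a).length = k) (l : List α) : (l.flatMap f).length = l.length * k := by
  induction l with
  | nil => simp
  | cons a l ih =>
    rw [List.flatMap_cons, List.length_append, hf, ih, List.length_cons]
    ring

theorem take_drop_flatMap {α β : Type*} (f : α → List β) {k : ℕ}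
    (hf : ∀ a, (f a).length = k) (l : List α) (j : ℕ) (hj : j < l.length) :
    ((l.flatMap f).drop (j * k)).take k = f l[j] := by
  induction l generalizing j with
  | nil => simp at hj
  | cons a l ih =>
    rw [List.flatMap_cons]
    cases j with
    | zero => simp [hf]
    | succ j =>
      have e : (j + 1) * k = (f a).length + j * k := by rw [hf]; ring
      rw [e, List.drop_append, List.drop_of_length_le (by omega), List.nil_append,
        Nat.add_sub_cancel_left, ih j (by simpa using hj)]
      simp

theorem size_le_commonWidth {l : List ℤ} {q : ℤ} (hq : q ∈ l) :
    q.natAbs.size ≤ commonWidth l := by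
  induction l with
  | nil => simp at hq
  | cons a l ih =>
    rw [commonWidth, List.map_cons, List.foldr_cons]
    rcases List.mem_cons.1 hq with rfl | h
    · exact le_max_left _ _
    · exact (ih h).trans (le_max_right _ _)

theorem commonWidth_le {l : List ℤ} {b : ℝ} (hb : 0 ≤ b)
    (h : ∀ q ∈ l, (q.natAbs.size : ℝ) ≤ b) : (commonWidth l : ℝ) ≤ b := by
  induction l with
  | nil => simpa [commonWidth] using hb
  | cons a l ih =>
    rw [commonWidth, List.map_cons, List.foldr_cons, Nat.cast_max]
    exact max_le (h a List.mem_cons_self) (ih fun q hq => h q (List.mem_cons_of_mem a hq))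

theorem length_encodeList (l : List ℤ) :
    (encodeList l).length = l.length * (commonWidth l + 1) :=
  length_flatMap_of_forall _ (length_encodeInt _) l

theorem decodeEntry_encodeList (l : List ℤ) (j : ℕ) (hj : j < l.length) :
    decodeEntry l.length (encodeList l) j = l[j] := by
  -- The width is not transmitted; the decoder recovers it from the length of the string.
  have hk : (encodeList l).length / l.length = commonWidth l + 1 := by
    rw [length_encodeList, Nat.mul_div_cancel_left _ (by omega)]
  rw [decodeEntry, hk, encodeList, take_drop_flatMap _ (length_encodeInt _) l j hj]
  refine decodeInt_encodeInt _ _ ((Nat.lt_size_self _).trans_le ?_)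
  exact Nat.pow_le_pow_right two_pos (size_le_commonWidth (List.getElem_mem hj))

/-- The factor `2` comes from `log 2 ≥ 1/2`. -/
theorem size_le_log {q : ℕ} {b : ℝ} (hb : 1 ≤ b) (hq : (q : ℝ) ≤ b) :
    (q.size : ℝ) ≤ 1 + 2 * Real.log b := by
  have hlog := Real.log_nonneg hb
  rcases Nat.eq_zero_or_pos q with rfl | h0
  · simp
    linarith
  obtain ⟨k, hk⟩ : ∃ k, q.size = k + 1 := ⟨q.size - 1, by have := Nat.size_pos.2 h0; omega⟩
  have h1 : 2 ^ k ≤ q := Nat.lt_size.1 (by omega)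
  have h2 : (2 : ℝ) ^ k ≤ b := le_trans (by exact_mod_cast h1) hq
  have h3 := Real.log_le_log (by positivity) h2
  rw [Real.log_pow] at h3
  have h4 := Real.log_two_gt_d9
  have h5 : (k : ℝ) * (1 / 2) ≤ k * Real.log 2 := by gcongr; linarith
  rw [hk]
  push_cast
  linarith

theorem truncate_bounds {τ : ℝ} (hτ : 0 < τ) (a : ℝ) :
    |truncate τ a * τ - a| ≤ τ ∧ |truncate τ a * τ - a| ≤ |a| ∧
      ((truncate τ a).natAbs : ℝ) ≤ |a| / τ := by
  have e : a / τ * τ = a := div_mul_cancel₀ a hτ.ne'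
  rw [Nat.cast_natAbs, Int.cast_abs, truncate]
  split_ifs with h
  · have h0 : 0 ≤ a / τ := div_nonneg h hτ.le
    have h1 := Int.floor_le (a / τ)
    have h2 := Int.lt_floor_add_one (a / τ)
    have h3 : (0 : ℝ) ≤ ⌊a / τ⌋ := by exact_mod_cast Int.floor_nonneg.2 h0
    have h4 : |(⌊a / τ⌋ : ℝ) * τ - a| = a - ⌊a / τ⌋ * τ := by
      rw [abs_sub_comm, abs_of_nonneg]
      nlinarith
    rw [h4, abs_of_nonneg h3, abs_of_nonneg h]
    refine ⟨by nlinarith, by nlinarith, h1⟩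
  · push Not at h
    have h0 : a / τ < 0 := div_neg_of_neg_of_pos h hτ
    have h1 := Int.le_ceil (a / τ)
    have h2 := Int.ceil_lt_add_one (a / τ)
    have h3 : (⌈a / τ⌉ : ℝ) ≤ 0 := by
      have : ⌈a / τ⌉ ≤ 0 := Int.ceil_le.2 (by exact_mod_cast h0.le)
      exact_mod_cast this
    have h4 : |(⌈a / τ⌉ : ℝ) * τ - a| = ⌈a / τ⌉ * τ - a := by
      rw [abs_of_nonneg]
      nlinarith
    rw [h4, abs_of_nonpos h3, abs_of_neg h]
    refine ⟨by nlinarith, by nlinarith, ?_⟩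
    rw [neg_div]
    linarith

theorem sum_selectedIndices {m : ℕ} (ω : Fin m → Bool) (f : Fin m → ℝ) :
    ((selectedIndices ω).map f).sum = ∑ i, if ω i then f i else 0 := by
  have hnd : (selectedIndices ω).Nodup := (List.nodup_finRange m).filter _
  rw [← List.sum_toFinset f hnd, selectedIndices, List.toFinset_filter, List.toFinset_finRange,
    Finset.sum_filter]

theorem length_selectedIndices {m : ℕ} (ω : Fin m → Bool) :
    ((selectedIndices ω).length : ℝ) = ∑ i, (if ω i then 1 else 0 : ℝ) := by
  rw [← sum_selectedIndices ω fun _ => 1]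
  simp

theorem mem_selectedIndices {m : ℕ} (ω : Fin m → Bool) (i : Fin m) :
    i ∈ selectedIndices ω ↔ ω i = true := by
  simp [selectedIndices]

/-! ## The compression scheme -/

section Scheme

variable {X : Type*} {m : ℕ}

/-- The truncated coefficients of a selection, extended by `0`. -/
def truncatedSolution (k : X → X → ℝ) (ε B M : ℝ) (s : Fin m → X × Set.Icc (0 : ℝ) 1)
    (ω : Fin m → Bool) (i : Fin m) : ℝ :=
  if ω i then
    truncate (precision ε M (selectedIndices ω).length)
      (sparseSolution (sampleGram k ε B s) ω (lambdaParam ε B) (fun j => ((s j).2 : ℝ)) i) *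
      precision ε M (selectedIndices ω).length
  else 0

theorem sampleGram_apply (k : X → X → ℝ) (ε : ℝ) {B : ℝ} (hm : 0 < m)
    (s : Fin m → X × Set.Icc (0 : ℝ) 1) (i j : Fin m) :
    sampleGram k ε B s i j = perturbedKernel k (ε ^ 3 / (5832 * B)) (s i).1 (s j).1 := by
  have hm' : (m : ℝ) ≠ 0 := by exact_mod_cast hm.ne'
  have h : gammaParam ε B m * m = ε ^ 3 / (5832 * B) := by
    rw [gammaParam, div_mul_eq_mul_div, mul_div_mul_right _ _ hm']
  rw [sampleGram, perturbedGram, Matrix.of_apply, h]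

theorem sampleGram_eq (k : X → X → ℝ) (ε : ℝ) {B : ℝ} (hm : 0 < m)
    (s : Fin m → X × Set.Icc (0 : ℝ) 1) :
    sampleGram k ε B s = (Matrix.of fun i j => k (s i).1 (s j).1) +
      etaParam ε B • collision fun i => (s i).1 := by
  ext i j
  rw [sampleGram_apply k ε hm]
  simp [perturbedKernel, collision, etaParam]

theorem perturbedKernel_comm {k : X → X → ℝ} (hk : ∀ x x', k x x' = k x' x) (r : ℝ) (x x' : X) :
    perturbedKernel k r x x' = perturbedKernel k r x' x := by
  rw [perturbedKernel, perturbedKernel, hk]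
  by_cases h : x = x'
  · simp [h]
  · simp [h, Ne.symm h]

theorem reconstructWith_compressWith {k : X → X → ℝ} (hk : ∀ x x', k x x' = k x' x)
    (ε B M : ℝ) (hm : 0 < m) (s : Fin m → X × Set.Icc (0 : ℝ) 1) (ω : Fin m → Bool)
    (i : Fin m) :
    reconstructWith k ε B M (compressWith k ε B M s ω) (s i).1 =
      clip01 ((sampleGram k ε B s *ᵥ truncatedSolution k ε B M s ω) i) := by
  set l := selectedIndices ω with hl
  set τ := precision ε M l.length with hτ
  set α := sparseSolution (sampleGram k ε B s) ω (lambdaParam ε B) (fun j => ((s j).2 : ℝ))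
    with hα
  -- Passes from positions in the sub-sample to indices of the sample, so that repeated sample
  -- points cause no ambiguity.
  have hsum : ∀ G : Fin (l.map s).length → ℝ, ∀ F : Fin m → ℝ,
      (∀ j, G j = F (l[j.1]'(by simpa using j.2))) → ∑ j, G j = (l.map F).sum := by
    intro G F hGF
    rw [← List.sum_ofFn]
    congr 1
    refine List.ext_getElem (by simp) fun j h1 h2 => ?_
    rw [List.getElem_ofFn, List.getElem_map, hGF]
  rw [reconstructWith]
  congr 1
  have h1 := hsum (fun j => perturbedKernel k (ε ^ 3 / (5832 * B)) ((l.map s).get j).1 (s i).1 *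
      ((decodeEntry (l.map s).length (compressWith k ε B M s ω).2 j : ℝ) *
        precision ε M (l.map s).length))
    (fun j => sampleGram k ε B s i j * (truncate τ (α j) * τ)) (by
      rintro ⟨j, hj⟩
      have hj' : j < l.length := by simpa using hj
      have h2 := decodeEntry_encodeList (l.map fun i => truncate τ (α i)) j (by simpa using hj')
      simp only [List.length_map, List.getElem_map] at h2
      have h3 : decodeEntry (l.map s).length (compressWith k ε B M s ω).2 j =
          truncate τ (α l[j]) := by
        rw [List.length_map]
        exact h2
      have h4 : precision ε M (l.map s).length = τ := by rw [List.length_map]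
      have h5 : perturbedKernel k (ε ^ 3 / (5832 * B)) ((l.map s)[j]).1 (s i).1 =
          sampleGram k ε B s i l[j] := by
        rw [sampleGram_apply k ε hm, List.getElem_map, perturbedKernel_comm hk]
      simp only [h3, h4, List.get_eq_getElem, h5])
  refine h1.trans ?_
  rw [hl, sum_selectedIndices, Matrix.mulVec, dotProduct]
  refine Finset.sum_congr rfl fun j _ => ?_
  rw [truncatedSolution]
  split_ifs with hj
  · rfl
  · rw [mul_zero]

theorem precision_pos {ε M : ℝ} (hε : 0 < ε) (hM : 0 < M) {n : ℕ} (hn : 0 < n) :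
    0 < precision ε M n := by
  have : (0 : ℝ) < n := by exact_mod_cast hn
  rw [precision]
  positivity

theorem truncatedSolution_bounds (k : X → X → ℝ) {ε M : ℝ} (B : ℝ) (hε : 0 < ε) (hM : 0 < M)
    (s : Fin m → X × Set.Icc (0 : ℝ) 1) (ω : Fin m → Bool) :
    (∀ i, |truncatedSolution k ε B M s ω i - sparseSolution (sampleGram k ε B s) ω
      (lambdaParam ε B) (fun j => ((s j).2 : ℝ)) i| ≤
        |sparseSolution (sampleGram k ε B s) ω (lambdaParam ε B) (fun j => ((s j).2 : ℝ)) i|) ∧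
    ∑ i, |truncatedSolution k ε B M s ω i - sparseSolution (sampleGram k ε B s) ω
      (lambdaParam ε B) (fun j => ((s j).2 : ℝ)) i| ≤ ε / (4 * M) := by
  set l := selectedIndices ω with hl
  set τ := precision ε M l.length with hτ
  set α := sparseSolution (sampleGram k ε B s) ω (lambdaParam ε B) (fun j => ((s j).2 : ℝ))
    with hα
  have hpos : ∀ i, ω i = true → 0 < τ := fun i hi => precision_pos hε hM
    (List.length_pos_of_mem ((mem_selectedIndices ω i).2 hi))
  have hsel : ∀ i, ω i = true → truncatedSolution k ε B M s ω i = truncate τ (α i) * τ := by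
    intro i hi
    rw [truncatedSolution, if_pos hi]
  have hnot : ∀ i, ω i ≠ true → |truncatedSolution k ε B M s ω i - α i| = 0 := by
    intro i hi
    have : α i = 0 := sparsifier_mulVec_of_not ω _ hi
    rw [truncatedSolution, if_neg hi, this]
    simp
  constructor
  · intro i
    by_cases hi : ω i = true
    · rw [hsel i hi]
      exact (truncate_bounds (hpos i hi) _).2.1
    · rw [hnot i hi]
      exact abs_nonneg _
  · have h1 : ∑ i, |truncatedSolution k ε B M s ω i - α i| ≤ ∑ i, (if ω i then τ else 0) := by
      refine Finset.sum_le_sum fun i _ => ?_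
      by_cases hi : ω i = true
      · rw [if_pos hi, hsel i hi]
        exact (truncate_bounds (hpos i hi) _).1
      · rw [if_neg hi, hnot i hi]
    refine h1.trans ?_
    rw [← sum_selectedIndices ω fun _ => τ, ← hl]
    simp only [List.map_const', List.sum_replicate, nsmul_eq_mul]
    rcases Nat.eq_zero_or_pos l.length with h0 | h0
    · rw [h0, Nat.cast_zero, zero_mul]
      positivity
    · have : (0 : ℝ) < l.length := by exact_mod_cast h0
      refine le_of_eq ?_
      rw [hτ, precision]
      field_simp

theorem compressedSize_compressWith (k : X → X → ℝ) (ε B M : ℝ)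
    (s : Fin m → X × Set.Icc (0 : ℝ) 1) (ω : Fin m → Bool) :
    compressedSize (compressWith k ε B M s ω) = (selectedIndices ω).length *
      (2 + commonWidth ((selectedIndices ω).map fun i =>
        truncate (precision ε M (selectedIndices ω).length)
          (sparseSolution (sampleGram k ε B s) ω (lambdaParam ε B)
            (fun j => ((s j).2 : ℝ)) i))) := by
  simp only [compressedSize, compressWith, length_encodeList, List.length_map]
  ring

theorem log_max_mul_le {R T : ℝ} (hR : 1 ≤ R) :
    Real.log (max 1 (R * T)) ≤ Real.log R + log₁ T := by
  have h1 := Real.log_nonneg hR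
  have h2 := one_le_log₁ T
  rcases le_total (R * T) 1 with h | h
  · rw [max_eq_left h, Real.log_one]
    linarith
  · have hT : T ≠ 0 := by
      rintro rfl
      simp at h
      linarith
    rw [max_eq_right h, Real.log_mul (by linarith) hT]
    have : Real.log T ≤ log₁ T := le_max_right _ _
    linarith

/-- The size of the compressed sample in terms of the number of selected points. -/
theorem compressedSize_le {k : X → X → ℝ} {ε B M : ℝ} (hε : 0 < ε) (hB : 0 < B) (hM : 0 < M)
    (hm : 0 < m) (s : Fin m → X × Set.Icc (0 : ℝ) 1)
    (hK : (Matrix.of fun i j => k (s i).1 (s j).1).PosSemidef) (ω : Fin m → Bool) {R D : ℝ}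
    (hR : 1 ≤ R) (hn : ((selectedIndices ω).length : ℝ) ≤ R * D) :
    (compressedSize (compressWith k ε B M s ω) : ℝ) ≤ (R * D) *
      ((5 + 2 * Real.log (23328 * R)) * log₁ (√(m : ℝ) * B * M * D / ε ^ 4)) := by
  set A := sampleGram k ε B s with hAdef
  set η := etaParam ε B with hηdef
  have hη : 0 < η := by rw [hηdef, etaParam]; positivity
  have hm' : 0 < (m : ℝ) := by exact_mod_cast hm
  have hAK := sampleGram_eq k ε (B := B) hm s
  rw [← hAdef, ← hηdef] at hAK
  have hA : A.PosSemidef := by rw [hAK]; exact hK.add ((collision_posSemidef _).smul hη.le)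
  have hAx : ∀ z, η * (z ⬝ᵥ collision (fun i => (s i).1) *ᵥ z) ≤ z ⬝ᵥ A *ᵥ z := by
    intro z
    have := posSemidef_dotProduct_nonneg hK z
    rw [hAK, Matrix.add_mulVec, dotProduct_add, Matrix.smul_mulVec, dotProduct_smul, smul_eq_mul]
    linarith
  have hrow : ∀ i j, (s i).1 = (s j).1 → A i = A j := by
    intro i j hij
    ext l
    rw [hAdef, sampleGram_apply k ε hm, sampleGram_apply k ε hm, hij]
  have hlam : 0 < lambdaParam ε B * m := by rw [lambdaParam]; positivity
  have hcoef := sq_sparseSolution_le hA hrow hAx hη ω hlam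
    (Y := fun j => ((s j).2 : ℝ)) (fun i => (s i).2.2.1) (fun i => (s i).2.2.2)
  rw [compressedSize_compressWith]
  set n := (selectedIndices ω).length with hndef
  set τ := precision ε M n with hτ
  set α := sparseSolution A ω (lambdaParam ε B) (fun j => ((s j).2 : ℝ)) with hα
  set T := √(m : ℝ) * B * M * D / ε ^ 4 with hT
  set b := max 1 (23328 * R * T) with hb
  have hb1 : 1 ≤ b := le_max_left _ _
  have hlogR : 0 ≤ Real.log (23328 * R) := Real.log_nonneg (by linarith)
  have hw : (commonWidth ((selectedIndices ω).map fun i => truncate τ (α i)) : ℝ) ≤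
      1 + 2 * Real.log b := by
    refine commonWidth_le (by have := Real.log_nonneg hb1; linarith) fun q hq => ?_
    obtain ⟨i, hi, rfl⟩ := List.mem_map.1 hq
    have hn0 : 0 < n := List.length_pos_of_mem hi
    have hn0' : (0 : ℝ) < n := by exact_mod_cast hn0
    refine size_le_log hb1 (((truncate_bounds (precision_pos hε hM hn0) _).2.2.trans ?_).trans
      (le_max_right _ _))
    have h1 : |η * α i| ≤ √(m : ℝ) := Real.abs_le_sqrt (hcoef i)
    rw [abs_mul, abs_of_pos hη] at h1
    -- `23328 = 4 · 5832`, from the precision `ε / (4 M n)` and `η = ε³ / (5832 B)`.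
    have h2 : |α i| / τ = 23328 * (B * M / ε ^ 4) * n * (η * |α i|) := by
      rw [hτ, precision, hηdef, etaParam]
      field_simp
      ring
    calc |α i| / τ = 23328 * (B * M / ε ^ 4) * n * (η * |α i|) := h2
      _ ≤ 23328 * (B * M / ε ^ 4) * (R * D) * √(m : ℝ) :=
          mul_le_mul (mul_le_mul_of_nonneg_left hn (by positivity)) h1 (by positivity)
            (mul_nonneg (by positivity) ((Nat.cast_nonneg n).trans hn))
      _ = 23328 * R * T := by rw [hT]; ring
  have hlog := log_max_mul_le (R := 23328 * R) (T := T) (by linarith)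
  rw [← hb] at hlog
  have hT1 := one_le_log₁ T
  -- Each selected index costs one sample point, one sign bit and the common width. Constants are
  -- absorbed using `log₁ T ≥ 1`.
  have h3 : (2 : ℝ) + commonWidth ((selectedIndices ω).map fun i => truncate τ (α i)) ≤
      (5 + 2 * Real.log (23328 * R)) * log₁ T := by nlinarith
  push_cast
  exact mul_le_mul hn h3 (by positivity) ((Nat.cast_nonneg n).trans hn)

end Scheme

/-! ### Feature Gram matrices and the ball of the hypothesis class -/

section Feature

variable {X 𝒦 : Type*} [NormedAddCommGroup 𝒦] [InnerProductSpace ℝ 𝒦] (ψ : X → 𝒦) {m : ℕ}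

theorem dotProduct_featureGram (x : Fin m → X) (a : Fin m → ℝ) :
    a ⬝ᵥ (Matrix.of fun i j => featureKernel ψ (x i) (x j)) *ᵥ a =
      ‖∑ i, a i • ψ (x i)‖ ^ 2 := by
  rw [← real_inner_self_eq_norm_sq, sum_inner, dotProduct]
  refine Finset.sum_congr rfl fun i _ => ?_
  rw [inner_sum, Matrix.mulVec, dotProduct, Finset.mul_sum]
  refine Finset.sum_congr rfl fun j _ => ?_
  rw [real_inner_smul_left, real_inner_smul_right, Matrix.of_apply, featureKernel]
  ring

theorem featureGram_posSemidef (x : Fin m → X) :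
    (Matrix.of fun i j => featureKernel ψ (x i) (x j)).PosSemidef := by
  refine Matrix.PosSemidef.of_dotProduct_mulVec_nonneg ?_ fun a => ?_
  · ext i j
    simp [featureKernel, real_inner_comm]
  · rw [star_trivial, dotProduct_featureGram]
    positivity

/-- The pairing is `⟨v, ∑ aᵢ ψ(xᵢ)⟩`; apply Cauchy–Schwarz and Young. Only this dual form of
membership in the class enters the regression estimate. -/
theorem two_mul_dotProduct_le_of_mem_rkhsBall {B : ℝ} {h : X → ℝ} (hh : h ∈ rkhsBall ψ B)
    (x : Fin m → X) {κ : ℝ} (hκ : 0 < κ) (a : Fin m → ℝ) :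
    2 * ((fun i => h (x i)) ⬝ᵥ a) ≤ κ * B +
      (a ⬝ᵥ (Matrix.of fun i j => featureKernel ψ (x i) (x j)) *ᵥ a) / κ := by
  obtain ⟨v, hv, rfl⟩ := hh
  rw [dotProduct_featureGram]
  have h1 : (fun i => inner ℝ v (ψ (x i))) ⬝ᵥ a = inner ℝ v (∑ i, a i • ψ (x i)) := by
    rw [inner_sum, dotProduct]
    refine Finset.sum_congr rfl fun i _ => ?_
    rw [real_inner_smul_right, mul_comm]
  rw [h1]
  set u := ∑ i, a i • ψ (x i)
  have h2 := real_inner_le_norm v u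
  rw [real_inner_self_eq_norm_sq] at hv
  have h3 : κ * B + ‖u‖ ^ 2 / κ ≥ κ * ‖v‖ ^ 2 + ‖u‖ ^ 2 / κ := by gcongr
  have h4 : 2 * (‖v‖ * ‖u‖) ≤ κ * ‖v‖ ^ 2 + ‖u‖ ^ 2 / κ := by
    rw [← sub_nonneg]
    have : κ * ‖v‖ ^ 2 + ‖u‖ ^ 2 / κ - 2 * (‖v‖ * ‖u‖) = (κ * ‖v‖ - ‖u‖) ^ 2 / κ := by
      field_simp
      ring
    rw [this]
    positivity
  linarith

end Feature

/-! ### Union bound and proof of the theorem -/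

open Classical in
theorem rlsSampling_good_ge {m : ℕ} {A : Matrix (Fin m) (Fin m) ℝ} (hA : A.PosSemidef) {η : ℝ}
    (hη : 0 < η * m) {c δ : ℝ} (hc : 1024 ≤ c) (hδ : 0 < δ) (hd : 1 / 3 ≤ effectiveDim A η) :
    ENNReal.ofReal (1 - δ) ≤ (rlsSampling A η c δ).toOuterMeasure
      {ω | IsGoodSelection A (η * m) ω ∧ ((selectedIndices ω).length : ℝ) ≤
        (2 * c + 9) * (effectiveDim A η * log₁ (effectiveDim A η / δ))} := by
  rw [rlsSampling_toOuterMeasure]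
  refine ENNReal.ofReal_le_ofReal ?_
  have h1 := sum_bernoulliWeight_not_isGoodSelection hA hη hc hδ (by linarith)
  have h2 := sum_bernoulliWeight_card_selection_gt hA hη (c := c) (by linarith) hδ hd
  have h3 : ∑ ω with ¬ (IsGoodSelection A (η * m) ω ∧ ((selectedIndices ω).length : ℝ) ≤
        (2 * c + 9) * (effectiveDim A η * log₁ (effectiveDim A η / δ))),
        bernoulliWeight (rlsProb A η c δ) ω ≤
      ∑ ω with ¬ IsGoodSelection A (η * m) ω, bernoulliWeight (rlsProb A η c δ) ω +
        ∑ ω with (2 * c + 9) * (effectiveDim A η * log₁ (effectiveDim A η / δ)) <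
          ∑ i, (if ω i then 1 else 0 : ℝ), bernoulliWeight (rlsProb A η c δ) ω := by
    rw [Finset.sum_filter, Finset.sum_filter, Finset.sum_filter, ← Finset.sum_add_distrib]
    refine Finset.sum_le_sum fun ω _ => ?_
    have hw := bernoulliWeight_nonneg (rlsProb_nonneg A η c δ) (rlsProb_le_one A η c δ) ω
    rw [length_selectedIndices]
    split_ifs <;> simp_all
  linarith

end KernelCompression

end

theorem mainTheorem4 :
    ∃ c₀ : ℝ, 0 < c₀ ∧ ∀ c : ℝ, c₀ ≤ c → ∃ C : ℝ, 0 < C ∧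
      ∀ (X : Type u) (𝒦 : Type v) [NormedAddCommGroup 𝒦] [InnerProductSpace ℝ 𝒦]
        [CompleteSpace 𝒦] (ψ : X → 𝒦) (ε δ B M : ℝ),
        0 < ε → 0 < δ → δ < 1 → 0 < B → 0 < M →
        (∀ x x' : X, |KernelCompression.featureKernel ψ x x'| ≤ M) →
        (KernelCompression.nystromScheme
            (KernelCompression.featureKernel ψ) c ε δ B M).IsApproxAgnosticCompression
          KernelCompression.squareLoss ε δ (KernelCompression.rkhsBall ψ B)
          (fun _ => True)
          (fun {m} s =>
            C * (KernelCompression.sampleDim (KernelCompression.featureKernel ψ) ε B s *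
              KernelCompression.log₁
                (KernelCompression.sampleDim (KernelCompression.featureKernel ψ) ε B s / δ) *
              KernelCompression.log₁
                (√(m : ℝ) * B * M *
                  KernelCompression.sampleDim (KernelCompression.featureKernel ψ) ε B s *
                  KernelCompression.log₁
                    (KernelCompression.sampleDim (KernelCompression.featureKernel ψ) ε B s / δ)
                  / ε ^ 4))) := by
  open KernelCompression Matrix in
  refine ⟨1024, by norm_num, fun c hc =>
    ⟨(2 * c + 9) * (5 + 2 * Real.log (23328 * (2 * c + 9))), ?_, ?_⟩⟩
  · have := Real.log_nonneg (x := 23328 * (2 * c + 9)) (by linarith)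
    have : 0 < 2 * c + 9 := by linarith
    positivity
  intro X 𝒦 _ _ _ ψ ε δ B M hε hδ _ hB hM hψ m s _
  set k := featureKernel ψ with hk
  change _ ≤ ((rlsSampling (sampleGram k ε B s) (etaParam ε B) c δ).map
    (compressWith k ε B M s)).toOuterMeasure _
  rw [PMF.toOuterMeasure_map_apply]
  -- An empty sample has `d = 0`, so the lower bound on `d` fails. The compressed sample is then
  -- empty and both average losses are `0`.
  rcases Nat.eq_zero_or_pos m with rfl | hm
  · refine le_of_le_of_eq (ENNReal.ofReal_le_one.2 (by linarith)) (Eq.symm ?_)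
    refine (PMF.toOuterMeasure_apply_eq_one_iff _ _).2 fun ω _ => ⟨?_, fun h _ => ?_⟩
    · simp [compressedSize_compressWith, selectedIndices, sampleDim, effectiveDim]
    · simp [avgLoss, hε.le]
  have hm' : 0 < (m : ℝ) := by exact_mod_cast hm
  set x : Fin m → X := fun i => (s i).1 with hx
  set A := sampleGram k ε B s with hAdef
  set η := etaParam ε B with hηdef
  set K : Matrix (Fin m) (Fin m) ℝ := Matrix.of fun i j => k (x i) (x j) with hKdef
  have hη : 0 < η := by rw [hηdef, etaParam]; positivity
  have hAK : A = K + η • collision x := sampleGram_eq k ε hm s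
  have hK : K.PosSemidef := featureGram_posSemidef ψ x
  have hA : A.PosSemidef := by rw [hAK]; exact hK.add ((collision_posSemidef _).smul hη.le)
  have hquad : ∀ z, z ⬝ᵥ A *ᵥ z = z ⬝ᵥ K *ᵥ z + η * (z ⬝ᵥ collision x *ᵥ z) := by
    intro z
    rw [hAK, Matrix.add_mulVec, dotProduct_add, Matrix.smul_mulVec, dotProduct_smul, smul_eq_mul]
  have hd : 1 / 3 ≤ effectiveDim A η := by
    refine effectiveDim_ge hA x hη (fun z => ?_) hm
    have := posSemidef_dotProduct_nonneg hK z
    rw [hquad]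
    linarith
  have hrow : ∀ i j, x i = x j → A i = A j := by
    intro i j hij
    have hij' : (s i).1 = (s j).1 := hij
    ext l
    rw [hAdef, sampleGram_apply k ε hm, sampleGram_apply k ε hm, hij']
  refine (rlsSampling_good_ge hA (mul_pos hη hm') hc hδ hd).trans
    (MeasureTheory.measure_mono ?_)
  rintro ω ⟨hgood, hcard⟩
  refine ⟨?_, fun h hh => ?_⟩
  · have h1 := compressedSize_le hε hB hM hm s hK ω (R := 2 * c + 9) (by linarith) hcard
    refine h1.trans (le_of_eq ?_)
    have e : sampleDim k ε B s = effectiveDim A η := rfl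
    beta_reduce
    rw [e, ← mul_assoc (√(m : ℝ) * B * M)]
    ring
  · have hb := truncatedSolution_bounds k B hε hM s ω
    have hfin := sum_clip01_sub_sq_le hε hB hM hm hK (fun i j => hψ _ _) hηdef hAK hrow hgood
      (Y := fun j => ((s j).2 : ℝ)) (fun i => (s i).2.2.1) (fun i => (s i).2.2.2)
      (truncatedSolution k ε B M s ω) hb.1 hb.2 (fun i => h (x i)) (fun κ hκ a => by
        refine (two_mul_dotProduct_le_of_mem_rkhsBall ψ hh x hκ a).trans ?_
        have h2 := posSemidef_dotProduct_nonneg (collision_posSemidef x) a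
        have h3 : a ⬝ᵥ K *ᵥ a ≤ a ⬝ᵥ A *ᵥ a := by
          rw [hquad]
          nlinarith
        gcongr)
    have hrec : ∀ i, (nystromScheme k c ε δ B M).reconstruct (compressWith k ε B M s ω) (s i).1 =
        clip01 ((A *ᵥ truncatedSolution k ε B M s ω) i) := fun i =>
      reconstructWith_compressWith (fun y y' => real_inner_comm _ _) ε B M hm s ω i
    simp only [avgLoss, squareLoss, hrec]
    exact hfin
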